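/- Let $n$ be a natural number, let $d_1,\dots,d_n$ be natural numbers, and let $\rho$ be a positive semidefinite operator (a not necessarily normalized $n$-partite state) on $\bigotimes_{i=1}^n\mathbb{C}^{d_i}$. For a subsystem $S\subseteq\{1,\dots,n\}$ let $\rho^{\Gamma_S}$ denote the partial transpose of $\rho$ with respect to $S$, i.e. the operator obtained by transposing, in the computational basis, the tensor factors with index in $S$: $\langle x|\rho^{\Gamma_S}|y\rangle=\langle x'|\rho|y'\rangle$, where $x'_i=y_i,\ y'_i=x_i$ for $i\in S$ and $x'_i=x_i,\ y'_i=y_i$ for $i\notin S$. Call an operator on $\bigotimes_{i=1}^n\mathbb{C}^{d_i}$ separable if it is a finite sum $\sum_k p_k|\psi_k\rangle\langle\psi_k|$ with $p_k\ge 0$ and product vectors $|\psi_k\rangle=|a_{k,1}\rangle\otimes\cdots\otimes|a_{k,n}\rangle$, $|a_{k,i}\rangle\in\mathbb{C}^{d_i}$. If $\rho^{\Gamma_S}$ has rank at most three for every $S\subseteq\{1,\dots,n\}$, then $\rho$ is separable, and $\rho^{\Gamma_S}$ is separable for every $S\subseteq\{1,\dots,n\}$. -/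

import Mathlib

open scoped ComplexOrder

/-- The computational basis of `⨂ i, ℂ^(d i)`: basis vectors `|x 0, …, x (n-1)⟩`. Operators on this
space are identified with the complex matrices indexed by this basis. -/
abbrev LocalBasis {n : ℕ} (d : Fin n → ℕ) : Type := ∀ i : Fin n, Fin (d i)

/-- An `n`-partite (not necessarily normalized) state: a positive semidefinite operator. -/
def IsState {n : ℕ} {d : Fin n → ℕ} (ρ : Matrix (LocalBasis d) (LocalBasis d) ℂ) : Prop :=
  ρ.PosSemidef

/-- The partial transpose with respect to the subsystem `S`: the row and column indices of the
parties in `S` are exchanged. -/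
def partialTranspose {n : ℕ} {d : Fin n → ℕ} (S : Finset (Fin n))
    (ρ : Matrix (LocalBasis d) (LocalBasis d) ℂ) : Matrix (LocalBasis d) (LocalBasis d) ℂ :=
  Matrix.of fun x y =>
    ρ (fun i => if i ∈ S then y i else x i) (fun i => if i ∈ S then x i else y i)

/-- The product vector `|a 0⟩ ⊗ … ⊗ |a (n-1)⟩` in the computational basis. -/
def productVector {n : ℕ} {d : Fin n → ℕ} (a : ∀ i : Fin n, Fin (d i) → ℂ) : LocalBasis d → ℂ :=
  fun x => ∏ i, a i (x i)

/-- (Full) separability of a non-normalized operator: a finite sum, with nonnegative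
weights, of operators `|ψ⟩⟨ψ|` with `|ψ⟩` an `n`-partite product vector. -/
def IsSeparableState {n : ℕ} {d : Fin n → ℕ} (ρ : Matrix (LocalBasis d) (LocalBasis d) ℂ) : Prop :=
  ∃ (N : ℕ) (p : Fin N → ℝ) (a : Fin N → ∀ i : Fin n, Fin (d i) → ℂ),
    (∀ k, 0 ≤ p k) ∧
      ρ = ∑ k, (p k : ℂ) • Matrix.vecMulVec (productVector (a k)) (star (productVector (a k)))

/-! Bipartite case. Write `ρ` as the Gram matrix of vectors `c a x`, bilinear in `(a, x)`, spanning
a space `V` with `dim V = rank ρ ≤ 3`. The partial transpose then has entries `⟨c b x, c a y⟩`, and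
its rank bound says that all its `4 × 4` minors vanish. The aim is an orthonormal basis of `V` in
which every coordinate of `c a x` is a product `α a * β x`; expanding the Gram matrix in it writes
`ρ` as a sum of at most three product states.

If some `c a₀` is onto, a full-rank block can be normalized to the identity and its Schur complement
vanishes: in dimension three because it is `1 × 1`, in dimension two because it is Hermitian,
traceless and of rank at most one on the diagonal `a = b`. This means `c a x = T a (c a₀ x)` with
every `T a` commuting with every adjoint `(T b)*`, so a common orthonormal eigenbasis is the
required one (`factorizes_of_schurForm_eq_zero`). In dimension one the minors are Kronecker
determinants. If `dim V ≥ 2` and all `c a` have rank at most one, they share a kernel and `c a x = g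
x • c a x₀`. What remains is `dim V = 3` with no map onto on either side and rank two on both; then
both arguments reduce to two dimensions (`exists_expansion_of_rank_two`). For two qubits the kernel
in `ℂ² ⊗ ℂ²` contains either a product vector, handled directly, or a vector of rank two, which a
change of basis turns into the singlet. Then `c` is symmetric, and a Hermitian kernel element of the
partial transpose produces a unitary taking `c u₀ u₀` to a multiple of `c u₀ u₁`, and that to a
multiple of `c u₁ u₁`; its eigenbasis works (`factorizes_of_symmetric`).

Multipartite case, by induction on the number of parties. Splitting off the first party gives `ρ = ∑
|α k⟩⟨α k| ⊗ σ k` (up to conjugation) with at most three terms. After merging terms with parallel `α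
k`, each remaining term is isolated by two functionals, one on each side, because each functional
only has to kill one of the at most two other vectors. Hence every partial transpose of `σ k` is a
compression of one of `ρ`, the rank bounds descend, and induction applies. Partial transposes of
separable operators are separable by conjugating local vectors. -/

/-! ### Common orthonormal eigenbases of commuting normal operators. -/

section SimultaneousDiagonalization

variable {V : Type*} [NormedAddCommGroup V] [InnerProductSpace ℂ V] [FiniteDimensional ℂ V]

/-- Commuting symmetric operators on a finite-dimensional space have a common orthonormal
eigenbasis. -/
theorem exists_common_eigenbasis_of_symmetric {ι : Type*} (T : ι → V →ₗ[ℂ] V)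
    (hT : ∀ i, (T i).IsSymmetric) (hC : ∀ i j, Commute (T i) (T j)) :
    ∃ (e : OrthonormalBasis (Fin (Module.finrank ℂ V)) ℂ V) (z : ι → Fin (Module.finrank ℂ V) → ℂ),
      ∀ i k, T i (e k) = z i k • e k := by
  classical
  have hdec := LinearMap.IsSymmetric.directSum_isInternal_of_pairwise_commute hT
    (fun i j _ => hC i j)
  have hfam := LinearMap.IsSymmetric.orthogonalFamily_iInf_eigenspaces hT
  rw [← DirectSum.isInternal_ne_bot_iff] at hdec
  have hfin := WellFoundedGT.finite_ne_bot_of_iSupIndep hfam.independent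
  have : Fintype {γ : ι → ℂ // ⨅ j, Module.End.eigenspace (T j) (γ j) ≠ ⊥} := hfin.fintype
  have hfam' := hfam.comp (Subtype.coe_injective
    (p := fun γ : ι → ℂ => ⨅ j, Module.End.eigenspace (T j) (γ j) ≠ ⊥))
  refine ⟨hdec.subordinateOrthonormalBasis rfl hfam',
    fun i k => (hdec.subordinateOrthonormalBasisIndex rfl k hfam').1 i, fun i k => ?_⟩
  have := hdec.subordinateOrthonormalBasis_subordinate rfl k hfam'
  exact Module.End.mem_eigenspace_iff.1 ((Submodule.mem_iInf _).1 this i)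

/-- Operators each of which commutes with the adjoints of all of them have a common
orthonormal eigenbasis. -/
theorem exists_common_eigenbasis_of_normal {ι : Type*} (T : ι → V →ₗ[ℂ] V)
    (hT : ∀ i j, Commute (LinearMap.adjoint (T i)) (T j)) :
    ∃ (e : OrthonormalBasis (Fin (Module.finrank ℂ V)) ℂ V) (z : ι → Fin (Module.finrank ℂ V) → ℂ),
      ∀ i k, T i (e k) = z i k • e k := by
  have : CompleteSpace V := FiniteDimensional.complete ℂ V
  have hcomm : ∀ i j, Commute (T i) (T j) := by
    intro i j
    have hstar : ∀ i, LinearMap.toContinuousLinearMap (LinearMap.adjoint (T i)) =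
        star (LinearMap.toContinuousLinearMap (T i)) := by
      intro i
      rw [LinearMap.adjoint_toContinuousLinearMap, ContinuousLinearMap.star_eq_adjoint]
    have h' : ∀ i j, Commute (star (LinearMap.toContinuousLinearMap (T i)))
        (LinearMap.toContinuousLinearMap (T j)) := by
      intro i j
      rw [← hstar]
      ext v
      exact LinearMap.congr_fun (hT i j).eq v
    have hn : IsStarNormal (star (LinearMap.toContinuousLinearMap (T i))) := by
      refine ⟨?_⟩
      rw [star_star]
      exact (h' i i).symm
    -- Fuglede's theorem: what commutes with a normal operator commutes with its adjoint.
    have := hn.commute_star_left (h' i j)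
    rw [star_star] at this
    ext v
    exact congrArg (fun f : V →L[ℂ] V => f v) this.eq
  have hcomm' : ∀ i j, Commute (LinearMap.adjoint (T i)) (LinearMap.adjoint (T j)) := by
    intro i j
    have := (hcomm i j).star_star
    simpa only [LinearMap.star_eq_adjoint] using this
  -- Twice the real part and minus twice the imaginary part of each `T i`; these are symmetric and
  -- commute pairwise.
  let H : ι × Bool → V →ₗ[ℂ] V := fun p =>
    if p.2 then T p.1 + LinearMap.adjoint (T p.1)
    else Complex.I • (T p.1 - LinearMap.adjoint (T p.1))
  obtain ⟨e, z, hz⟩ := exists_common_eigenbasis_of_symmetric H (by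
    rintro ⟨i, b⟩
    rw [LinearMap.isSymmetric_iff_isSelfAdjoint, isSelfAdjoint_iff]
    cases b
    · simp only [H, Bool.false_eq_true, if_false, star_smul, star_sub, ← LinearMap.star_eq_adjoint,
        star_star, Complex.star_def, Complex.conj_I]
      rw [neg_smul, ← smul_neg, neg_sub]
    · simp only [H, if_true, star_add, ← LinearMap.star_eq_adjoint, star_star]
      rw [add_comm]) (by
    rintro ⟨i, b⟩ ⟨j, b'⟩
    have h1 := hcomm i j
    have h2 := hcomm' i j
    have h3 := hT i j
    have h4 := (hT j i).symm
    cases b <;> cases b' <;> simp only [H, Bool.false_eq_true, if_false, if_true]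
    · exact (((h1.sub_left h3).sub_right (h4.sub_left h2)).smul_left _).smul_right _
    · exact (((h1.sub_left h3).add_right (h4.sub_left h2)).smul_left _)
    · exact (((h1.add_left h3).sub_right (h4.add_left h2)).smul_right _)
    · exact ((h1.add_left h3).add_right (h4.add_left h2)))
  refine ⟨e, fun i k => (z (i, true) k - Complex.I * z (i, false) k) / 2, fun i k => ?_⟩
  have h1 := hz (i, true) k
  have h2 := hz (i, false) k
  simp only [H, Bool.false_eq_true, if_false, if_true, LinearMap.add_apply, LinearMap.smul_apply,
    LinearMap.sub_apply] at h1 h2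
  have h3 : T i (e k) - LinearMap.adjoint (T i) (e k) = (-Complex.I * z (i, false) k) • e k := by
    rw [mul_smul, ← h2, smul_smul]
    simp
  have h4 : (2 : ℂ) • T i (e k) = (z (i, true) k - Complex.I * z (i, false) k) • e k := by
    rw [sub_eq_add_neg, ← neg_mul, add_smul, ← h1, ← h3, two_smul]
    abel
  beta_reduce
  rw [div_eq_inv_mul, mul_smul, ← h4, smul_smul]
  norm_num

end SimultaneousDiagonalization

/-! ### Bilinear maps, Schur complements, and the case of a surjective `c a₀`. -/

section Tensor

variable {E F V : Type*} [AddCommGroup E] [Module ℂ E] [AddCommGroup F] [Module ℂ F]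
  [NormedAddCommGroup V] [InnerProductSpace ℂ V]

/-- All `4 × 4` minors of the partial transpose of the Gram matrix of the vectors `c a x` vanish. -/
def HasLowRankTranspose (c : E →ₗ[ℂ] F →ₗ[ℂ] V) : Prop :=
  ∀ (a : Fin 4 → E) (x : Fin 4 → F) (b : Fin 4 → E) (y : Fin 4 → F),
    (Matrix.of fun i j => inner ℂ (c (b j) (x i)) (c (a i) (y j))).det = 0

/-- In some orthonormal basis, every coordinate of `c a x` is a product of a function of `a` and a
function of `x`. -/
def Factorizes (c : E →ₗ[ℂ] F →ₗ[ℂ] V) : Prop :=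
  ∃ e : OrthonormalBasis (Fin (Module.finrank ℂ V)) ℂ V, ∀ k, ∃ (α : E → ℂ) (β : F → ℂ),
    ∀ a x, inner ℂ (e k) (c a x) = α a * β x

/-- Only the zero vector is orthogonal to all `c a x`. -/
def HasTotalRange (c : E →ₗ[ℂ] F →ₗ[ℂ] V) : Prop :=
  ∀ w : V, (∀ a x, inner ℂ w (c a x) = 0) → w = 0

namespace HasLowRankTranspose

variable {c : E →ₗ[ℂ] F →ₗ[ℂ] V}

theorem det_eq_zero (hc : HasLowRankTranspose c) {κ : Type*} [Fintype κ] [DecidableEq κ]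
    (hκ : Fintype.card κ = 4) (a : κ → E) (x : κ → F) (b : κ → E) (y : κ → F) :
    (Matrix.of fun i j => inner ℂ (c (b j) (x i)) (c (a i) (y j))).det = 0 := by
  let f := Fintype.equivFinOfCardEq hκ
  rw [← Matrix.det_submatrix_equiv_self f.symm]
  exact hc (a ∘ f.symm) (x ∘ f.symm) (b ∘ f.symm) (y ∘ f.symm)

theorem flip (hc : HasLowRankTranspose c) : HasLowRankTranspose c.flip := by
  intro a x b y
  rw [← Matrix.det_transpose]
  exact hc y b x a

theorem comp (hc : HasLowRankTranspose c) {E' F' : Type*} [AddCommGroup E'] [Module ℂ E']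
    [AddCommGroup F'] [Module ℂ F'] (f : E' →ₗ[ℂ] E) (g : F' →ₗ[ℂ] F) :
    HasLowRankTranspose (c.compl₁₂ f g) := by
  intro a x b y
  exact hc (f ∘ a) (g ∘ x) (f ∘ b) (g ∘ y)

end HasLowRankTranspose

theorem Factorizes.of_flip {c : E →ₗ[ℂ] F →ₗ[ℂ] V} (h : Factorizes c.flip) : Factorizes c := by
  obtain ⟨e, he⟩ := h
  refine ⟨e, fun k => ?_⟩
  obtain ⟨α, β, h⟩ := he k
  exact ⟨β, α, fun a x => by rw [mul_comm]; exact h x a⟩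

theorem HasTotalRange.flip {c : E →ₗ[ℂ] F →ₗ[ℂ] V} (h : HasTotalRange c) : HasTotalRange c.flip :=
  fun w hw => h w fun a x => hw x a

/-- Factorization may be checked on finitely many vectors in terms of which all values of `c`
expand. -/
theorem factorizes_of_expansion {c : E →ₗ[ℂ] F →ₗ[ℂ] V} {ι κ : Type*} [Fintype ι] [Fintype κ]
    (u : ι → E) (v : κ → F) (f : E → ι → ℂ) (g : F → κ → ℂ)
    (hc : ∀ a x, c a x = ∑ i, ∑ j, (f a i * g x j) • c (u i) (v j))
    (h : ∃ e : OrthonormalBasis (Fin (Module.finrank ℂ V)) ℂ V, ∀ k, ∃ (α : ι → ℂ) (β : κ → ℂ),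
      ∀ i j, inner ℂ (e k) (c (u i) (v j)) = α i * β j) : Factorizes c := by
  obtain ⟨e, he⟩ := h
  refine ⟨e, fun k => ?_⟩
  obtain ⟨α, β, h⟩ := he k
  refine ⟨fun a => ∑ i, f a i * α i, fun x => ∑ j, g x j * β j, fun a x => ?_⟩
  rw [hc, inner_sum, Finset.sum_mul_sum]
  refine Finset.sum_congr rfl fun i _ => ?_
  rw [inner_sum]
  refine Finset.sum_congr rfl fun j _ => ?_
  rw [inner_smul_right, h]
  ring

/-- The Schur complement, in the partially transposed Gram matrix, of the block of rows and columns
`(a₀, y i)`. -/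
noncomputable def schurForm (c : E →ₗ[ℂ] F →ₗ[ℂ] V) {ι : Type*} [Fintype ι] (a₀ : E) (y : ι → F)
    (a : E) (x : F) (b : E) (x' : F) : ℂ :=
  inner ℂ (c b x) (c a x') - ∑ i, inner ℂ (c a₀ x) (c a (y i)) * inner ℂ (c b (y i)) (c a₀ x')

/-- Orthonormality makes the block of rows and columns `(a₀, y i)` the identity, so the `4 × 4`
minor bordering it equals the determinant of its Schur complement. -/
theorem det_schurForm_eq_zero {c : E →ₗ[ℂ] F →ₗ[ℂ] V} (hc : HasLowRankTranspose c)
    {ι κ : Type*} [Fintype ι] [Fintype κ] [DecidableEq ι] [DecidableEq κ]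
    (hcard : Fintype.card ι + Fintype.card κ = 4) (a₀ : E) (y : ι → F)
    (hy : Orthonormal ℂ fun i => c a₀ (y i)) (a : κ → E) (x : κ → F) (b : κ → E) (x' : κ → F) :
    (Matrix.of fun i j => schurForm c a₀ y (a i) (x i) (b j) (x' j)).det = 0 := by
  have h := hc.det_eq_zero (κ := ι ⊕ κ) (by simpa using hcard) (Sum.elim (fun _ => a₀) a)
    (Sum.elim y x) (Sum.elim (fun _ => a₀) b) (Sum.elim y x')
  have h1 : (Matrix.of fun i j : ι ⊕ κ =>
      inner ℂ (c (Sum.elim (fun _ => a₀) b j) (Sum.elim y x i))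
        (c (Sum.elim (fun _ => a₀) a i) (Sum.elim y x' j))) =
      Matrix.fromBlocks 1 (Matrix.of fun i j => inner ℂ (c (b j) (y i)) (c a₀ (x' j)))
        (Matrix.of fun i j => inner ℂ (c a₀ (x i)) (c (a i) (y j)))
        (Matrix.of fun i j => inner ℂ (c (b j) (x i)) (c (a i) (x' j))) := by
    ext (i | i) (j | j)
    · simpa [Matrix.one_apply] using orthonormal_iff_ite.1 hy i j
    · rfl
    · rfl
    · rfl
  rw [h1, Matrix.det_fromBlocks_one₁₁] at h
  rw [← h]
  congr 1

theorem schurForm_mul_eq {c : E →ₗ[ℂ] F →ₗ[ℂ] V} (hc : HasLowRankTranspose c) (a₀ : E)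
    (y : Fin 2 → F) (hy : Orthonormal ℂ fun i => c a₀ (y i)) (a a' : E) (x x' : F) (b b' : E)
    (w w' : F) :
    schurForm c a₀ y a x b w * schurForm c a₀ y a' x' b' w' =
      schurForm c a₀ y a x b' w' * schurForm c a₀ y a' x' b w := by
  have h := det_schurForm_eq_zero hc (κ := Fin 2) (by simp) a₀ y hy ![a, a'] ![x, x'] ![b, b']
    ![w, w']
  rw [Matrix.det_fin_two] at h
  simpa [sub_eq_zero] using h

/-- A vector `x` killed by `a₀` but not by `b` gives a vector `c b x` orthogonal to the range of
`c a₀`. -/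
theorem inner_eq_zero_of_ker {c : E →ₗ[ℂ] F →ₗ[ℂ] V} (hc : HasLowRankTranspose c) (a₀ : E)
    (y : Fin 2 → F) (hy : Orthonormal ℂ fun i => c a₀ (y i)) (x : F) (hx : c a₀ x = 0) (b : E)
    (w : F) : inner ℂ (c b x) (c a₀ w) = 0 := by
  by_cases hv : c b x = 0
  · simp [hv]
  -- As `c a₀ x = 0`, this vanishing `2 × 2` minor reads `⟨c b x, c a₀ w⟩ * ‖c b x‖² = 0`.
  have h := schurForm_mul_eq hc a₀ y hy a₀ b x x b b w x
  simp only [schurForm, hx, inner_zero_left, inner_zero_right, zero_mul, mul_zero,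
    Finset.sum_const_zero, sub_zero] at h
  exact (mul_eq_zero.1 h).resolve_right (by simpa using hv)

variable [FiniteDimensional ℂ V]

/-- If the Schur complement of a block of full rank vanishes, `c` is given by commuting normal
operators. -/
theorem factorizes_of_schurForm_eq_zero {c : E →ₗ[ℂ] F →ₗ[ℂ] V} {ι : Type*} [Fintype ι] (a₀ : E)
    (y : ι → F) (e : OrthonormalBasis ι ℂ V) (hy : ∀ i, c a₀ (y i) = e i)
    (h : ∀ a x b x', schurForm c a₀ y a x b x' = 0) : Factorizes c := by
  -- When `c a₀ x = 0`, the Schur form at `(a, x, a, x)` is `‖c a x‖²`.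
  have hker : ∀ x, c a₀ x = 0 → ∀ a, c a x = 0 := by
    intro x hx a
    have := h a x a x
    simpa [schurForm, hx] using this
  let T : E → V →ₗ[ℂ] V := fun a => e.toBasis.constr ℂ fun i => c a (y i)
  have hTe : ∀ a i, T a (e i) = c a (y i) := by
    intro a i
    have := e.toBasis.constr_basis ℂ (fun i => c a (y i)) i
    rwa [e.coe_toBasis] at this
  have hT : ∀ a x, c a x = T a (c a₀ x) := by
    intro a x
    have h1 : c a (x - ∑ i, inner ℂ (e i) (c a₀ x) • y i) = 0 := by
      apply hker
      simp only [map_sub, map_sum, map_smul, hy]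
      rw [e.sum_repr', sub_self]
    rw [map_sub, sub_eq_zero] at h1
    conv_rhs => rw [← e.sum_repr' (c a₀ x)]
    rw [h1]
    simp only [map_sum, map_smul, hTe]
  have hsurj : ∀ v, ∃ x, c a₀ x = v := by
    intro v
    refine ⟨∑ i, inner ℂ (e i) v • y i, ?_⟩
    simp only [map_sum, map_smul, hy]
    exact e.sum_repr' v
  -- For `v = c a₀ x` and `w = c a₀ x'`, vanishing of the Schur form reads `⟨T a v, T b w⟩ = ∑ i,
  -- ⟨v, T b (e i)⟩ * ⟨T a (e i), w⟩`, and the right side is `⟨(T b)* v, (T a)* w⟩`.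
  have hcomm : ∀ a b, Commute (LinearMap.adjoint (T b)) (T a) := by
    intro b a
    refine LinearMap.ext fun w => ext_inner_left ℂ fun v => ?_
    obtain ⟨x, rfl⟩ := hsurj v
    obtain ⟨x', rfl⟩ := hsurj w
    have := h b x a x'
    rw [schurForm, sub_eq_zero] at this
    rw [Module.End.mul_apply, Module.End.mul_apply, LinearMap.adjoint_inner_right, ← hT, ← hT, this,
      ← LinearMap.adjoint_inner_left, ← e.sum_inner_mul_inner]
    refine Finset.sum_congr rfl fun i _ => ?_
    rw [LinearMap.adjoint_inner_left, LinearMap.adjoint_inner_right, hTe, hTe]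
  obtain ⟨ε, z, hz⟩ := exists_common_eigenbasis_of_normal T (fun i j => hcomm j i)
  refine ⟨ε, fun k => ⟨fun a => z a k, fun x => inner ℂ (ε k) (c a₀ x), fun a x => ?_⟩⟩
  rw [hT]
  conv_lhs => rw [← ε.sum_repr' (c a₀ x)]
  simp only [map_sum, map_smul, hz, inner_sum, inner_smul_right]
  rw [Finset.sum_eq_single k]
  · simp [mul_comm]
  · intro j _ hj
    simp [ε.inner_eq_ite, hj.symm]
  · simp

/-- The identity block already has order three, so each single entry of the Schur complement is a `4
× 4` minor. -/
theorem factorizes_of_surjective_three {c : E →ₗ[ℂ] F →ₗ[ℂ] V} (hc : HasLowRankTranspose c)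
    (hV : Module.finrank ℂ V = 3) (a₀ : E) (ha : Function.Surjective (c a₀)) : Factorizes c := by
  let e := stdOrthonormalBasis ℂ V
  choose y hy using fun i => ha (e i)
  refine factorizes_of_schurForm_eq_zero a₀ y e hy fun a x b x' => ?_
  have h := det_schurForm_eq_zero hc (κ := Unit) (by simp [hV]) a₀ y
    (by simpa only [hy] using e.orthonormal) (fun _ => a) (fun _ => x) (fun _ => b) (fun _ => x')
  simpa using h

/-- A block of order two only bounds the rank of the Schur complement by one. For `a = b`, however,
its matrix on the `y i` is the self-commutator `T* T - T T*` of the operator `T` sending `e i` to `c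
a (y i)`: Hermitian, traceless and of rank at most one, hence zero. Polarization extends this to `a
≠ b`. -/
theorem factorizes_of_surjective_two {c : E →ₗ[ℂ] F →ₗ[ℂ] V} (hc : HasLowRankTranspose c)
    (hV : Module.finrank ℂ V = 2) (a₀ : E) (ha : Function.Surjective (c a₀)) : Factorizes c := by
  let e := (stdOrthonormalBasis ℂ V).reindex (finCongr hV)
  choose y hy using fun i => ha (e i)
  have hon : Orthonormal ℂ fun i => c a₀ (y i) := by simpa only [hy] using e.orthonormal
  have hker : ∀ x, c a₀ x = 0 → ∀ a, c a x = 0 := by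
    intro x hx a
    obtain ⟨w, hw⟩ := ha (c a x)
    have := inner_eq_zero_of_ker hc a₀ y hon x hx a w
    rwa [hw, inner_self_eq_zero] at this
  have hexp : ∀ a x, c a x = ∑ i, inner ℂ (e i) (c a₀ x) • c a (y i) := by
    intro a x
    have h1 : c a (x - ∑ i, inner ℂ (e i) (c a₀ x) • y i) = 0 := by
      apply hker
      simp only [map_sub, map_sum, map_smul, hy]
      rw [e.sum_repr', sub_self]
    rw [map_sub, sub_eq_zero] at h1
    rw [h1]
    simp only [map_sum, map_smul]
  have hdiag : ∀ a i j, schurForm c a₀ y a (y i) a (y j) = 0 := by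
    intro a
    have hherm : ∀ i j, schurForm c a₀ y a (y i) a (y j) =
        (starRingEnd ℂ) (schurForm c a₀ y a (y j) a (y i)) := by
      intro i j
      simp only [schurForm, map_sub, map_sum, map_mul, inner_conj_symm]
      congr 1
      exact Finset.sum_congr rfl fun _ _ => mul_comm _ _
    have htr : schurForm c a₀ y a (y 0) a (y 0) + schurForm c a₀ y a (y 1) a (y 1) = 0 := by
      simp only [schurForm, hy]
      rw [← e.sum_inner_mul_inner (c a (y 0)) (c a (y 0)),
        ← e.sum_inner_mul_inner (c a (y 1)) (c a (y 1))]
      simp only [Fin.sum_univ_two]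
      ring
    have hdet := schurForm_mul_eq hc a₀ y hon a a (y 0) (y 1) a a (y 0) (y 1)
    rw [hherm 1 0, Complex.mul_conj, eq_neg_of_add_eq_zero_right htr] at hdet
    have hre : (starRingEnd ℂ) (schurForm c a₀ y a (y 0) a (y 0)) =
        schurForm c a₀ y a (y 0) a (y 0) := (hherm 0 0).symm
    obtain ⟨r, hr⟩ := Complex.conj_eq_iff_real.1 hre
    rw [hr] at hdet htr
    -- The diagonal entries are `r` and `-r`, so the vanishing determinant equates `-r²` with a
    -- nonnegative number.
    have hdet' : r * -r = Complex.normSq (schurForm c a₀ y a (y 0) a (y 1)) := by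
      exact_mod_cast hdet
    have hn := Complex.normSq_nonneg (schurForm c a₀ y a (y 0) a (y 1))
    have hr0 : r = 0 := by nlinarith
    have h01 : schurForm c a₀ y a (y 0) a (y 1) = 0 := by
      rw [← Complex.normSq_eq_zero, ← hdet', hr0]; simp
    have h10 := hherm 1 0
    rw [h01, map_zero] at h10
    rw [hr0] at hr htr
    simp only [Complex.ofReal_zero, zero_add] at htr hr
    intro i j
    fin_cases i <;> fin_cases j <;> assumption
  -- Polarization: the form is linear in `a` and conjugate-linear in `b`, so its diagonal values at
  -- `a + b`, `a + I • b`, `a` and `b` determine it.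
  have hpol : ∀ a b i j, schurForm c a₀ y a (y i) b (y j) = 0 := by
    intro a b i j
    have h1 := hdiag (a + b) i j
    have h2 := hdiag (a + Complex.I • b) i j
    have h3 := hdiag a i j
    have h4 := hdiag b i j
    simp only [schurForm, map_add, map_smul, LinearMap.add_apply, LinearMap.smul_apply,
      inner_add_left, inner_add_right, inner_smul_left, inner_smul_right, Fin.sum_univ_two,
      Complex.conj_I] at h1 h2 h3 h4 ⊢
    have hI : Complex.I ^ 2 = -1 := Complex.I_sq
    linear_combination (1 / 2 : ℂ) * h1 + (Complex.I / 2) * h2 - (1 / 2 + Complex.I / 2) * h3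
      - (1 / 2 + Complex.I / 2) * h4
      + (1 / 2 : ℂ) * (inner ℂ (c b (y i)) (c a (y j))
        - inner ℂ (c a₀ (y i)) (c a (y 0)) * inner ℂ (c b (y 0)) (c a₀ (y j))
        - inner ℂ (c a₀ (y i)) (c a (y 1)) * inner ℂ (c b (y 1)) (c a₀ (y j))
        - inner ℂ (c a (y i)) (c b (y j))
        + inner ℂ (c a₀ (y i)) (c b (y 0)) * inner ℂ (c a (y 0)) (c a₀ (y j))
        + inner ℂ (c a₀ (y i)) (c b (y 1)) * inner ℂ (c a (y 1)) (c a₀ (y j))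
        + Complex.I * (inner ℂ (c b (y i)) (c b (y j))
        - inner ℂ (c a₀ (y i)) (c b (y 0)) * inner ℂ (c b (y 0)) (c a₀ (y j))
        - inner ℂ (c a₀ (y i)) (c b (y 1)) * inner ℂ (c b (y 1)) (c a₀ (y j)))) * hI
  refine factorizes_of_schurForm_eq_zero a₀ y e hy fun a x b x' => ?_
  have : schurForm c a₀ y a x b x' = ∑ i, ∑ j, (starRingEnd ℂ) (inner ℂ (e i) (c a₀ x)) *
      inner ℂ (e j) (c a₀ x') * schurForm c a₀ y a (y i) b (y j) := by
    simp only [schurForm]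
    rw [hexp b x, hexp a x', hexp a₀ x, hexp a₀ x']
    simp only [Fin.sum_univ_two, inner_add_left, inner_add_right, inner_smul_left,
      inner_smul_right, hy, e.inner_eq_ite, map_add, map_mul]
    simp
    ring
  rw [this]
  simp [hpol]

end Tensor

/-! ### Dimension one, rank at most one, and reduction of rank two to a two-dimensional argument. -/

section TensorCases

variable {E F V : Type*} [AddCommGroup E] [Module ℂ E] [AddCommGroup F] [Module ℂ F]
  [NormedAddCommGroup V] [InnerProductSpace ℂ V]

theorem factorizes_of_orthonormalBasis {c : E →ₗ[ℂ] F →ₗ[ℂ] V} {ι : Type*} [Fintype ι]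
    (e : OrthonormalBasis ι ℂ V)
    (h : ∀ k, ∃ (α : E → ℂ) (β : F → ℂ), ∀ a x, inner ℂ (e k) (c a x) = α a * β x) :
    Factorizes c := by
  have hcard : Fintype.card ι = Module.finrank ℂ V := (Module.finrank_eq_card_basis e.toBasis).symm
  refine ⟨e.reindex (Fintype.equivFinOfCardEq hcard), fun k => ?_⟩
  rw [e.reindex_apply]
  exact h _

variable [FiniteDimensional ℂ V]

/-- With scalar values, a suitable `4 × 4` minor is the determinant of `M ⊗ Mᴴ`, where `M` is a `2 ×
2` block of the form `c`. So all `2 × 2` minors of the form vanish, and it has rank at most one. -/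
theorem factorizes_of_finrank_eq_one {c : E →ₗ[ℂ] F →ₗ[ℂ] V} (hc : HasLowRankTranspose c)
    (hV : Module.finrank ℂ V = 1) : Factorizes c := by
  let e := (stdOrthonormalBasis ℂ V).reindex (finCongr hV)
  refine factorizes_of_orthonormalBasis e fun k => ?_
  have hinner : ∀ v w : V, inner ℂ v w = inner ℂ v (e k) * inner ℂ (e k) w := by
    intro v w
    rw [← e.sum_inner_mul_inner v w, Fintype.sum_eq_single k]
    exact fun j hj => absurd (Subsingleton.elim j k) hj
  have hminor : ∀ a b x y, inner ℂ (e k) (c a x) * inner ℂ (e k) (c b y) =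
      inner ℂ (e k) (c a y) * inner ℂ (e k) (c b x) := by
    intro a b x y
    let M : Matrix (Fin 2) (Fin 2) ℂ :=
      Matrix.of fun i j => inner ℂ (e k) (c (![a, b] i) (![x, y] j))
    have h := hc.det_eq_zero (κ := Fin 2 × Fin 2) (by simp) (fun p => ![a, b] p.1)
      (fun p => ![x, y] p.2) (fun p => ![a, b] p.2) (fun p => ![x, y] p.1)
    have h1 : (Matrix.of fun p q : Fin 2 × Fin 2 =>
        inner ℂ (c (![a, b] q.2) (![x, y] p.2)) (c (![a, b] p.1) (![x, y] q.1))) =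
        Matrix.kroneckerMap (· * ·) M M.conjTranspose := by
      ext p q
      rw [Matrix.of_apply, hinner, mul_comm]
      simp [M, Matrix.kroneckerMap_apply]
    rw [h1, Matrix.det_kronecker, Matrix.det_conjTranspose] at h
    have h2 : M.det = 0 := by simpa using h
    rw [Matrix.det_fin_two] at h2
    simpa [M, sub_eq_zero] using h2
  by_cases h0 : ∃ a x, inner ℂ (e k) (c a x) ≠ 0
  · obtain ⟨a₀, x₀, h0⟩ := h0
    refine ⟨fun a => inner ℂ (e k) (c a x₀) / inner ℂ (e k) (c a₀ x₀),
      fun x => inner ℂ (e k) (c a₀ x), fun a x => ?_⟩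
    rw [div_mul_eq_mul_div, eq_div_iff h0, hminor]
  · push Not at h0
    exact ⟨fun _ => 0, fun _ => 0, fun a x => by simp [h0]⟩

theorem exists_orthogonal_ne_zero {s : Submodule ℂ V} (hs : s ≠ ⊤) :
    ∃ w : V, w ≠ 0 ∧ ∀ v ∈ s, inner ℂ w v = 0 := by
  have : sᗮ ≠ ⊥ := fun h => hs (Submodule.orthogonal_eq_bot_iff.1 h)
  obtain ⟨w, hw, hw0⟩ := Submodule.exists_mem_ne_zero_of_ne_bot this
  exact ⟨w, hw0, fun v hv => (Submodule.mem_orthogonal' s w).1 hw v hv⟩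

/-- The case in which each `c a` has rank at most one. -/
theorem factorizes_of_rank_le_one {c : E →ₗ[ℂ] F →ₗ[ℂ] V} (ht : HasTotalRange c)
    (hV : 2 ≤ Module.finrank ℂ V)
    (h1 : ∀ a x x', ¬ LinearIndependent ℂ ![c a x, c a x']) : Factorizes c := by
  -- If `c a y = 0` but `c b y ≠ 0`, then `c (a + b)` takes independent values at `x` and `y`,
  -- contradicting rank at most one.
  have hker : ∀ a b x x', LinearIndependent ℂ ![c a x, c b x'] → ∀ y, c a y = 0 → c b y = 0 := by
    intro a b x x' hli y hy
    have hw : c b x' ≠ 0 := hli.ne_zero 1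
    have hd := h1 b x'
    simp only [LinearIndependent.pair_iff' hw, not_forall, not_not] at hd
    obtain ⟨ν, hν⟩ := hd y
    obtain ⟨μ, hμ⟩ := hd x
    by_contra hby
    refine h1 (a + b) x y ?_
    have hν0 : ν ≠ 0 := by
      rintro rfl
      exact hby (by simpa using hν.symm)
    simp only [map_add, LinearMap.add_apply, hy, zero_add]
    rw [← hν, ← hμ]
    rw [LinearIndependent.pair_iff] at hli ⊢
    intro s t hst
    have := hli s (s * μ + t * ν) (by rw [← hst]; module)
    obtain ⟨hs, ht⟩ := this
    rw [hs] at ht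
    refine ⟨hs, ?_⟩
    simpa [hν0] using ht
  obtain ⟨a₀, x₀, hv⟩ : ∃ a₀ x₀, c a₀ x₀ ≠ 0 := by
    by_contra! hall
    have : Nontrivial V := Module.nontrivial_of_finrank_pos (R := ℂ) (by omega)
    obtain ⟨w, hw⟩ := exists_ne (0 : V)
    exact hw (ht w fun a x => by rw [hall, inner_zero_right])
  -- Totality in dimension at least two forbids all images from lying in one line.
  obtain ⟨b, x₁, hli⟩ : ∃ b x₁, LinearIndependent ℂ ![c a₀ x₀, c b x₁] := by
    by_contra! hall
    simp only [LinearIndependent.pair_iff' hv, not_forall, not_not] at hall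
    obtain ⟨w, hw, hw'⟩ := exists_orthogonal_ne_zero (s := ℂ ∙ c a₀ x₀) (by
      intro htop
      have := finrank_span_singleton (K := ℂ) hv
      rw [htop, finrank_top] at this
      omega)
    refine hw (ht w fun a x => hw' _ ?_)
    obtain ⟨t, ht⟩ := hall a x
    exact Submodule.mem_span_singleton.2 ⟨t, ht⟩
  -- If the image of `c a` lies in the line of `c a₀ x₀`, the kernels are compared through `b`,
  -- whose image contains another direction.
  have hker₀ : ∀ y, c a₀ y = 0 → ∀ a, c a y = 0 := by
    intro y hy a
    by_cases hx : ∃ x, LinearIndependent ℂ ![c a₀ x₀, c a x]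
    · obtain ⟨x, hx⟩ := hx
      exact hker _ _ _ _ hx y hy
    · push Not at hx
      by_contra hay
      have h2 := hx y
      simp only [LinearIndependent.pair_iff' hv, not_forall, not_not] at h2
      obtain ⟨t, ht⟩ := h2
      have ht0 : t ≠ 0 := by
        rintro rfl
        exact hay (by simpa using ht.symm)
      refine hay (hker b a x₁ y ?_ y (hker _ _ _ _ hli y hy))
      rw [← ht]
      rw [LinearIndependent.pair_iff] at hli ⊢
      intro p q hpq
      have := hli (q * t) p (by rw [← hpq]; module)
      exact ⟨this.2, by simpa [ht0] using this.1⟩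
  have hg : ∀ x, ∃ t : ℂ, t • c a₀ x₀ = c a₀ x := by
    intro x
    have := h1 a₀ x₀ x
    simpa only [LinearIndependent.pair_iff' hv, not_forall, not_not] using this
  choose g hg using hg
  -- Inclusion of kernels yields `c a x = g x • c a x₀`, which factorizes in any orthonormal basis.
  refine ⟨stdOrthonormalBasis ℂ V, fun k => ⟨fun a => inner ℂ (stdOrthonormalBasis ℂ V k) (c a x₀),
    g, fun a x => ?_⟩⟩
  have : c a (x - g x • x₀) = 0 := hker₀ _ (by simp [hg]) a
  rw [map_sub, map_smul, sub_eq_zero] at this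
  rw [this, inner_smul_right, mul_comm]

theorem exists_orthonormalBasis_extending_pair (hV : Module.finrank ℂ V = 3) {u v : V}
    (hu : ‖u‖ = 1) (hv : ‖v‖ = 1) (huv : inner ℂ u v = 0) :
    ∃ b : OrthonormalBasis (Fin 3) ℂ V, b 0 = u ∧ b 1 = v := by
  have hvu : inner ℂ v u = 0 := inner_eq_zero_symm.1 huv
  obtain ⟨b, hb⟩ := Orthonormal.exists_orthonormalBasis_extension_of_card_eq (𝕜 := ℂ) (E := V)
    (ι := Fin 3) (by simpa using hV) (v := ![u, v, 0]) (s := {0, 1}) (by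
      constructor
      · rintro ⟨i, rfl | rfl⟩
        · simpa using hu
        · simpa using hv
      · rintro ⟨i, rfl | rfl⟩ ⟨j, rfl | rfl⟩ hij
        · exact absurd rfl hij
        · simpa using huv
        · simpa using hvu
        · exact absurd rfl hij)
  exact ⟨b, by simpa using hb 0 (by simp), by simpa using hb 1 (by simp)⟩

/-- If no `c a` has full rank three but some has rank two, the second argument effectively ranges
over a two-dimensional space. -/
theorem exists_expansion_of_rank_two {c : E →ₗ[ℂ] F →ₗ[ℂ] V} (hc : HasLowRankTranspose c)
    (hV : Module.finrank ℂ V = 3) (hs : ∀ a, ¬ Function.Surjective (c a)) {a₀ : E} {x₁ x₂ : F}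
    (hli : LinearIndependent ℂ ![c a₀ x₁, c a₀ x₂]) :
    ∃ (y : Fin 2 → F) (g : F → Fin 2 → ℂ), ∀ a x, c a x = ∑ j, g x j • c a (y j) := by
  have hR : Module.finrank ℂ (LinearMap.range (c a₀)) = 2 := by
    apply le_antisymm
    · have : Module.finrank ℂ (LinearMap.range (c a₀)) < Module.finrank ℂ V :=
        Submodule.finrank_lt (fun h => hs a₀ (LinearMap.range_eq_top.1 h))
      omega
    · have h := (finrank_span_eq_card hli).symm.le.trans (Submodule.finrank_mono
        (t := LinearMap.range (c a₀)) (Submodule.span_le.2 (by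
          rintro _ ⟨i, rfl⟩
          fin_cases i
          · exact ⟨x₁, rfl⟩
          · exact ⟨x₂, rfl⟩)))
      simpa using h
  let e := (stdOrthonormalBasis ℂ (LinearMap.range (c a₀))).reindex (finCongr hR)
  choose y hy using fun i => (e i).2
  have hon : Orthonormal ℂ fun i => c a₀ (y i) := by
    simp only [hy]
    exact e.orthonormal.comp_linearIsometry (LinearMap.range (c a₀)).subtypeₗᵢ
  have hker : ∀ x, c a₀ x = 0 → ∀ b, c b x = 0 := by
    intro x hx b
    by_contra hv
    have hperp := inner_eq_zero_of_ker hc a₀ y hon x hx b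
    obtain ⟨β, hβ0, hβ1⟩ := exists_orthonormalBasis_extending_pair hV (hon.1 0) (hon.1 1)
      (hon.2 (by decide : (0 : Fin 2) ≠ 1))
    beta_reduce at hβ0 hβ1
    -- By `hperp`, `c b x` spans the direction `β 2` and lies in the range of `c (a₀ + t • b)`.
    -- Since that map is not onto, its compression to the span of `β 0`, `β 1` on `y 0`, `y 1`,
    -- namely `1 + t B`, must be singular: a vector `u` orthogonal to the range has no `β 2`
    -- component.
    have hdet : ∀ t : ℂ, t ≠ 0 →
        (1 + t * inner ℂ (β 0) (c b (y 0))) * (1 + t * inner ℂ (β 1) (c b (y 1))) -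
          t * inner ℂ (β 0) (c b (y 1)) * (t * inner ℂ (β 1) (c b (y 0))) = 0 := by
      intro t ht
      obtain ⟨u, hu0, hu⟩ := exists_orthogonal_ne_zero (s := LinearMap.range (c (a₀ + t • b)))
        (fun h => hs _ (LinearMap.range_eq_top.1 h))
      have hu' : ∀ w, inner ℂ u (c a₀ w + t • c b w) = 0 := by
        intro w
        simpa using hu _ ⟨w, rfl⟩
      have hux : inner ℂ u (c b x) = 0 := by
        have := hu' x
        rw [hx, zero_add, inner_smul_right] at this
        exact (mul_eq_zero.1 this).resolve_left ht
      have hexp : ∀ w, inner ℂ u w = inner ℂ u (β 0) * inner ℂ (β 0) w +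
          inner ℂ u (β 1) * inner ℂ (β 1) w + inner ℂ u (β 2) * inner ℂ (β 2) w := by
        intro w
        rw [← β.sum_inner_mul_inner u w, Fin.sum_univ_three]
      have hb0 : inner ℂ (β 0) (c b x) = 0 := by
        rw [hβ0]; exact inner_eq_zero_symm.1 (hperp _)
      have hb1 : inner ℂ (β 1) (c b x) = 0 := by
        rw [hβ1]; exact inner_eq_zero_symm.1 (hperp _)
      have hb2 : inner ℂ (β 2) (c b x) ≠ 0 := by
        intro hb2
        apply hv
        rw [← β.sum_repr' (c b x), Fin.sum_univ_three, hb0, hb1, hb2]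
        simp
      have hu2 : inner ℂ u (β 2) = 0 := by
        have := hexp (c b x)
        rw [hux, hb0, hb1] at this
        simpa [hb2] using this
      have e0 := hu' (y 0)
      have e1 := hu' (y 1)
      rw [← hβ0, inner_add_right, inner_smul_right, hexp (c b (y 0)), hu2] at e0
      rw [← hβ1, inner_add_right, inner_smul_right, hexp (c b (y 1)), hu2] at e1
      by_contra hne
      have hz0 : inner ℂ u (β 0) = 0 := by
        refine (mul_eq_zero.1 (?_ : inner ℂ u (β 0) * _ = 0)).resolve_right hne
        linear_combination (1 + t * inner ℂ (β 1) (c b (y 1))) * e0 -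
          (t * inner ℂ (β 1) (c b (y 0))) * e1
      have hz1 : inner ℂ u (β 1) = 0 := by
        refine (mul_eq_zero.1 (?_ : inner ℂ u (β 1) * _ = 0)).resolve_right hne
        linear_combination (1 + t * inner ℂ (β 0) (c b (y 0))) * e1 -
          (t * inner ℂ (β 0) (c b (y 1))) * e0
      apply hu0
      rw [← inner_self_eq_zero (𝕜 := ℂ), hexp, hz0, hz1, hu2]
      simp
    have d1 := hdet 1 one_ne_zero
    have d2 := hdet (-1) (by norm_num)
    have d3 := hdet 2 two_ne_zero
    -- `det (1 + t B)` is a quadratic in `t` with constant term one; `3 p(1) + p(-1) - p(2)` cancels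
    -- its linear and quadratic terms and leaves three.
    have : (3 : ℂ) = 0 := by
      linear_combination 3 * d1 + d2 - d3
    norm_num at this
  refine ⟨y, fun x i => inner ℂ (c a₀ (y i)) (c a₀ x), fun a x => ?_⟩
  have h0 : c a₀ (x - ∑ i, inner ℂ (c a₀ (y i)) (c a₀ x) • y i) = 0 := by
    simp only [map_sub, map_sum, map_smul, sub_eq_zero]
    have := e.sum_repr' ⟨c a₀ x, x, rfl⟩
    have h2 := congrArg Subtype.val this
    simp only [hy]
    simpa using h2.symm
  have h1 := hker _ h0 a
  simp only [map_sub, map_sum, map_smul, sub_eq_zero] at h1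
  exact h1

end TensorCases

/-! ### Symmetric two-qubit maps without product vectors in the kernel. -/

section TwoQubits

variable {E F V : Type*} [AddCommGroup E] [Module ℂ E] [AddCommGroup F] [Module ℂ F]
  [NormedAddCommGroup V] [InnerProductSpace ℂ V]

theorem bilinear_basis_expansion (c : E →ₗ[ℂ] F →ₗ[ℂ] V) {ι κ : Type*} [Fintype ι] [Fintype κ]
    (p : Module.Basis ι ℂ E) (q : Module.Basis κ ℂ F) (a : E) (x : F) :
    c a x = ∑ i, ∑ j, (p.repr a i * q.repr x j) • c (p i) (q j) := by
  conv_lhs => rw [← p.sum_repr a, ← q.sum_repr x]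
  simp only [map_sum, map_smul, LinearMap.sum_apply, LinearMap.smul_apply, Finset.smul_sum,
    smul_smul]
  rw [Finset.sum_comm]
  simp only [mul_comm]

/-- A nonzero Hermitian matrix in the kernel of the partially transposed Gram matrix of a symmetric
bilinear map. -/
theorem exists_hermitian_mem_ker {c : (Fin 2 → ℂ) →ₗ[ℂ] (Fin 2 → ℂ) →ₗ[ℂ] V}
    (hc : HasLowRankTranspose c) (hsymm : ∀ u v, c u v = c v u) :
    ∃ H : Matrix (Fin 2) (Fin 2) ℂ, H.IsHermitian ∧ H ≠ 0 ∧ ∀ i j, ∑ k, ∑ l,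
      inner ℂ (c (Pi.single k 1) (Pi.single j 1)) (c (Pi.single i 1) (Pi.single l 1)) * H k l =
        0 := by
  have hdet := hc.det_eq_zero (κ := Fin 2 × Fin 2) (by simp) (fun p => Pi.single p.1 1)
    (fun p => Pi.single p.2 1) (fun p => Pi.single p.1 1) (fun p => Pi.single p.2 1)
  obtain ⟨m, hm0, hm⟩ := Matrix.exists_mulVec_eq_zero_iff.2 hdet
  have hM : ∀ i j, ∑ k, ∑ l, inner ℂ (c (Pi.single k 1) (Pi.single j 1))
      (c (Pi.single i 1) (Pi.single l 1)) * m (k, l) = 0 := by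
    intro i j
    have := congrFun hm (i, j)
    simpa [Matrix.mulVec, dotProduct, Fintype.sum_prod_type] using this
  -- Symmetry of `c` makes the kernel stable under conjugate transposition, so it contains a
  -- Hermitian element: `M + Mᴴ`, or `I • M` when that sum is zero.
  have hM' : ∀ i j, ∑ k, ∑ l, inner ℂ (c (Pi.single k 1) (Pi.single j 1))
      (c (Pi.single i 1) (Pi.single l 1)) * (starRingEnd ℂ) (m (l, k)) = 0 := by
    intro i j
    have := congrArg (starRingEnd ℂ) (hM j i)
    simp only [map_sum, map_mul, inner_conj_symm, map_zero] at this
    rw [Finset.sum_comm, ← this]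
    refine Finset.sum_congr rfl fun k _ => Finset.sum_congr rfl fun l _ => ?_
    rw [hsymm (Pi.single l 1), hsymm (Pi.single i 1)]
  let M : Matrix (Fin 2) (Fin 2) ℂ := Matrix.of fun k l => m (k, l)
  have hM0 : M ≠ 0 := by
    intro h
    apply hm0
    ext p
    exact congrFun (congrFun h p.1) p.2
  by_cases h : M + M.conjTranspose = 0
  · refine ⟨Complex.I • M, ?_, ?_, ?_⟩
    · rw [Matrix.IsHermitian, Matrix.conjTranspose_smul, eq_neg_of_add_eq_zero_right h]
      simp
    · simpa using hM0
    · intro i j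
      have := congrArg (Complex.I * ·) (hM i j)
      simp only [Finset.mul_sum, mul_zero] at this
      rw [← this]
      refine Finset.sum_congr rfl fun k _ => Finset.sum_congr rfl fun l _ => ?_
      simp only [M, Matrix.smul_apply, Matrix.of_apply, smul_eq_mul]
      ring
  · refine ⟨M + M.conjTranspose, ?_, h, ?_⟩
    · rw [Matrix.IsHermitian, Matrix.conjTranspose_add, Matrix.conjTranspose_conjTranspose, add_comm]
    · intro i j
      rw [← add_zero (0 : ℂ), ← congrArg₂ (· + ·) (hM i j) (hM' i j)]
      rw [← Finset.sum_add_distrib]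
      refine Finset.sum_congr rfl fun k _ => ?_
      rw [← Finset.sum_add_distrib]
      refine Finset.sum_congr rfl fun l _ => ?_
      simp only [M, Matrix.add_apply, Matrix.of_apply, Matrix.conjTranspose_apply,
        Complex.star_def]
      ring

variable [FiniteDimensional ℂ V]

/-- Two vectors and their images under an isometric relation: if the pairs `(P, S)` and `(S, Q)`
have the same Gram matrix, then in some orthonormal basis the coordinates of `P, S, Q` are
geometric progressions. -/
theorem exists_geometric_coordinates {P S Q : V} (hli : LinearIndependent ℂ ![P, S])
    (h1 : ‖P‖ = ‖S‖) (h2 : ‖S‖ = ‖Q‖) (h3 : inner ℂ P S = inner ℂ S Q) :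
    ∃ (e : OrthonormalBasis (Fin (Module.finrank ℂ V)) ℂ V) (z : Fin (Module.finrank ℂ V) → ℂ),
      ∀ k, inner ℂ (e k) S = z k * inner ℂ (e k) P ∧ inner ℂ (e k) Q = z k * inner ℂ (e k) S := by
  let φ : (Fin 2 → ℂ) →ₗ[ℂ] V := Fintype.linearCombination ℂ ![P, S]
  let ψ : (Fin 2 → ℂ) →ₗ[ℂ] V := Fintype.linearCombination ℂ ![S, Q]
  have hφ : Function.Injective φ := linearIndependent_iff_injective_fintypeLinearCombination.1 hli
  have hφ' : ∀ t, φ t = t 0 • P + t 1 • S := by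
    intro t; simp [φ, Fintype.linearCombination_apply]
  have hψ' : ∀ t, ψ t = t 0 • S + t 1 • Q := by
    intro t; simp [ψ, Fintype.linearCombination_apply]
  have hnorm : ∀ t, ‖ψ t‖ = ‖φ t‖ := by
    intro t
    have h3' : inner ℂ S P = inner ℂ Q S := by
      rw [← inner_conj_symm, h3, inner_conj_symm]
    have : inner ℂ (ψ t) (ψ t) = inner ℂ (φ t) (φ t) := by
      rw [hφ', hψ']
      simp only [inner_add_left, inner_add_right, inner_smul_left, inner_smul_right, h3, h3']
      rw [inner_self_eq_norm_sq_to_K P, inner_self_eq_norm_sq_to_K S,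
        inner_self_eq_norm_sq_to_K Q, h1, h2]
    rw [inner_self_eq_norm_sq_to_K, inner_self_eq_norm_sq_to_K] at this
    have h' : ‖ψ t‖ ^ 2 = ‖φ t‖ ^ 2 := by exact_mod_cast this
    exact (sq_eq_sq₀ (norm_nonneg _) (norm_nonneg _)).1 h'
  -- Equal Gram matrices make `P ↦ S`, `S ↦ Q` an isometry on the span of `P` and `S`. It extends to
  -- a unitary of `V`, whose eigenvalues are the ratios of the progressions.
  let L : LinearMap.range φ →ₗᵢ[ℂ] V :=
    { toLinearMap := ψ ∘ₗ (LinearEquiv.ofInjective φ hφ).symm.toLinearMap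
      norm_map' := by
        rintro ⟨_, t, rfl⟩
        have : (LinearEquiv.ofInjective φ hφ).symm ⟨φ t, t, rfl⟩ = t := by
          rw [LinearEquiv.symm_apply_eq]
          rfl
        simp only [LinearMap.comp_apply, LinearEquiv.coe_coe, this]
        exact hnorm t }
  have hL : ∀ t, L.extend (φ t) = ψ t := by
    intro t
    have := L.extend_apply ⟨φ t, t, rfl⟩
    rw [this]
    change ψ ((LinearEquiv.ofInjective φ hφ).symm ⟨φ t, t, rfl⟩) = ψ t
    congr 1
    rw [LinearEquiv.symm_apply_eq]
    rfl
  have hW1 : L.extend P = S := by simpa [hφ', hψ'] using hL ![1, 0]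
  have hW2 : L.extend S = Q := by simpa [hφ', hψ'] using hL ![0, 1]
  let W : V →ₗ[ℂ] V := L.extend.toLinearMap
  have hW : LinearMap.adjoint W * W = 1 := by
    refine LinearMap.ext fun w => ext_inner_left ℂ fun v => ?_
    rw [Module.End.mul_apply, LinearMap.adjoint_inner_right]
    exact L.extend.inner_map_map v w
  have hWW : W * LinearMap.adjoint W = 1 := mul_eq_one_comm.1 hW
  obtain ⟨e, z, hz⟩ := exists_common_eigenbasis_of_normal (fun _ : Unit => W)
    (fun _ _ => by rw [Commute, SemiconjBy, hW, hWW])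
  have hcoord : ∀ k v, inner ℂ (e k) (W v) = z () k * inner ℂ (e k) v := by
    intro k v
    conv_lhs => rw [← e.sum_repr' v]
    simp only [map_sum, map_smul, hz (), inner_sum, inner_smul_right]
    rw [Finset.sum_eq_single k]
    · simp [mul_comm]
    · intro j _ hj
      simp [e.inner_eq_ite, hj.symm]
    · simp
  refine ⟨e, z (), fun k => ⟨?_, ?_⟩⟩
  · rw [← hcoord]; congr 1; exact hW1.symm
  · rw [← hcoord]; congr 1; exact hW2.symm

/-- Diagonalizing the Hermitian kernel element gives a basis `u` and real `lam` with `∑ i, lam i *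
⟨c (u i) x, c a (u i)⟩ = 0`. Evaluated on `u`, this says that `P = c (u 0) (u 0)`, `S = c (u 0) (u
1)`, `Q = c (u 1) (u 1)` become, after rescaling to `P, τ S, τ² Q`, a sequence with equal
consecutive Gram matrices, so `exists_geometric_coordinates` applies. -/
theorem factorizes_of_symmetric {c : (Fin 2 → ℂ) →ₗ[ℂ] (Fin 2 → ℂ) →ₗ[ℂ] V}
    (hc : HasLowRankTranspose c) (hsymm : ∀ u v, c u v = c v u)
    (hnd : ∀ u v, c u v = 0 → u = 0 ∨ v = 0) : Factorizes c := by
  obtain ⟨H, hH, hH0, hker⟩ := exists_hermitian_mem_ker hc hsymm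
  obtain ⟨U, lam, hU2, hHU⟩ : ∃ (U : Matrix (Fin 2) (Fin 2) ℂ) (lam : Fin 2 → ℝ),
      U.conjTranspose * U = 1 ∧
      ∀ k l, H k l = ∑ i, U k i * lam i * (starRingEnd ℂ) (U l i) := by
    refine ⟨hH.eigenvectorUnitary, hH.eigenvalues,
      Unitary.star_mul_self_of_mem hH.eigenvectorUnitary.2, fun k l => ?_⟩
    conv_lhs => rw [hH.spectral_theorem]
    simp [Unitary.conjStarAlgAut_apply, Matrix.mul_apply, Matrix.diagonal_apply, Matrix.star_apply]
  -- Conjugated eigenvectors, because the inner product is conjugate-linear in its first slot.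
  let u : Fin 2 → Fin 2 → ℂ := fun i k => (starRingEnd ℂ) (U k i)
  have hexp : ∀ v w, c v w = ∑ i, ∑ j, (v i * w j) • c (Pi.single i 1) (Pi.single j 1) := by
    intro v w
    simpa using bilinear_basis_expansion c (Pi.basisFun ℂ (Fin 2)) (Pi.basisFun ℂ (Fin 2)) v w
  have hform : ∀ a x, lam 0 * inner ℂ (c (u 0) x) (c a (u 0)) +
      lam 1 * inner ℂ (c (u 1) x) (c a (u 1)) = 0 := by
    intro a x
    have h00 := hker 0 0
    have h01 := hker 0 1
    have h10 := hker 1 0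
    have h11 := hker 1 1
    simp only [hHU, Fin.sum_univ_two] at h00 h01 h10 h11
    rw [hexp (u 0) x, hexp (u 1) x, hexp a (u 0), hexp a (u 1)]
    simp only [Fin.sum_univ_two, inner_add_left, inner_add_right, inner_smul_left,
      inner_smul_right, u, map_mul, Complex.conj_conj]
    linear_combination a 0 * (starRingEnd ℂ) (x 0) * h00 + a 0 * (starRingEnd ℂ) (x 1) * h01 +
      a 1 * (starRingEnd ℂ) (x 0) * h10 + a 1 * (starRingEnd ℂ) (x 1) * h11
  have hlam : ¬ (lam 0 = 0 ∧ lam 1 = 0) := by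
    rintro ⟨h0, h1⟩
    apply hH0
    ext k l
    simp [hHU, h0, h1]
  have hli : LinearIndependent ℂ u := by
    rw [Fintype.linearIndependent_iff]
    intro g hg i
    have h1 : ∀ k, ∑ j, g j * (starRingEnd ℂ) (U k j) = 0 := by
      intro k
      simpa [u] using congrFun hg k
    have h2 : ∀ j, ∑ k, U k i * (starRingEnd ℂ) (U k j) = if j = i then 1 else 0 := by
      intro j
      have := congrFun (congrFun hU2 j) i
      rw [Matrix.mul_apply, Matrix.one_apply] at this
      rw [← this]
      exact Finset.sum_congr rfl fun k _ => by simp [mul_comm]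
    have h3 : ∑ k, U k i * ∑ j, g j * (starRingEnd ℂ) (U k j) = 0 := by simp [h1]
    simp only [Finset.mul_sum] at h3
    rw [Finset.sum_comm] at h3
    have h4 : ∀ j, ∑ k, U k i * (g j * (starRingEnd ℂ) (U k j)) = g j * if j = i then 1 else 0 := by
      intro j
      rw [← h2, Finset.mul_sum]
      exact Finset.sum_congr rfl fun k _ => by ring
    simpa [h4] using h3
  let p := basisOfLinearIndependentOfCardEqFinrank hli (by simp)
  have hp : ∀ i, p i = u i := fun i => by simp [p]
  have hu0 : ∀ i, u i ≠ 0 := fun i => hli.ne_zero i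
  have hP : c (u 0) (u 0) ≠ 0 := fun h => (hnd _ _ h).elim (hu0 0) (hu0 0)
  have hS : c (u 0) (u 1) ≠ 0 := fun h => (hnd _ _ h).elim (hu0 0) (hu0 1)
  have hS' : c (u 1) (u 0) = c (u 0) (u 1) := hsymm _ _
  have hsq : ∀ v : V, inner ℂ v v = ((‖v‖ ^ 2 : ℝ) : ℂ) := by
    intro v
    rw [inner_self_eq_norm_sq_to_K]
    push_cast
    rfl
  have r1 : lam 0 * ‖c (u 0) (u 0)‖ ^ 2 + lam 1 * ‖c (u 0) (u 1)‖ ^ 2 = 0 := by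
    have := hform (u 0) (u 0)
    rw [hS', hsq, hsq] at this
    exact_mod_cast this
  have r2 : lam 0 * ‖c (u 0) (u 1)‖ ^ 2 + lam 1 * ‖c (u 1) (u 1)‖ ^ 2 = 0 := by
    have := hform (u 1) (u 1)
    rw [hS', hsq, hsq] at this
    exact_mod_cast this
  have r3 : lam 0 * inner ℂ (c (u 0) (u 0)) (c (u 0) (u 1)) +
      lam 1 * inner ℂ (c (u 0) (u 1)) (c (u 1) (u 1)) = 0 := by
    have := hform (u 1) (u 0)
    rwa [hS'] at this
  have hPn : 0 < ‖c (u 0) (u 0)‖ := norm_pos_iff.2 hP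
  have hSn : 0 < ‖c (u 0) (u 1)‖ := norm_pos_iff.2 hS
  have hlam0 : lam 0 ≠ 0 := by
    intro h
    refine hlam ⟨h, ?_⟩
    rw [h, zero_mul, zero_add] at r1
    exact (mul_eq_zero.1 r1).resolve_right (by positivity)
  -- By `r1` the two eigenvalues have opposite signs, and `τ² = -lam 1 / lam 0`.
  obtain ⟨τ, hτ, hτP⟩ : ∃ τ : ℝ, 0 < τ ∧ ‖c (u 0) (u 0)‖ = τ * ‖c (u 0) (u 1)‖ :=
    ⟨‖c (u 0) (u 0)‖ / ‖c (u 0) (u 1)‖, by positivity, by field_simp⟩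
  have hlam1 : lam 1 = -(lam 0 * τ ^ 2) := by
    rw [hτP] at r1
    have : (lam 1 + lam 0 * τ ^ 2) * ‖c (u 0) (u 1)‖ ^ 2 = 0 := by linear_combination r1
    have := (mul_eq_zero.1 this).resolve_right (by positivity)
    linarith
  have hτS : ‖c (u 0) (u 1)‖ = τ * ‖c (u 1) (u 1)‖ := by
    rw [hlam1] at r2
    have h1 : lam 0 * (‖c (u 0) (u 1)‖ ^ 2 - (τ * ‖c (u 1) (u 1)‖) ^ 2) = 0 := by
      linear_combination r2
    have h2 := (mul_eq_zero.1 h1).resolve_left hlam0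
    exact (sq_eq_sq₀ hSn.le (by positivity)).1 (sub_eq_zero.1 h2)
  have hτi : inner ℂ (c (u 0) (u 0)) (c (u 0) (u 1)) =
      (τ : ℂ) ^ 2 * inner ℂ (c (u 0) (u 1)) (c (u 1) (u 1)) := by
    rw [hlam1] at r3
    push_cast at r3
    have h1 : (lam 0 : ℂ) * (inner ℂ (c (u 0) (u 0)) (c (u 0) (u 1)) -
        (τ : ℂ) ^ 2 * inner ℂ (c (u 0) (u 1)) (c (u 1) (u 1))) = 0 := by
      linear_combination r3
    exact sub_eq_zero.1 ((mul_eq_zero.1 h1).resolve_left (by exact_mod_cast hlam0))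
  have hτ0 : (τ : ℂ) ≠ 0 := by exact_mod_cast hτ.ne'
  obtain ⟨e, z, hz⟩ := exists_geometric_coordinates (P := c (u 0) (u 0))
    (S := (τ : ℂ) • c (u 0) (u 1)) (Q := ((τ : ℂ) ^ 2) • c (u 1) (u 1))
    (by
      rw [LinearIndependent.pair_iff]
      intro s t hst
      have h1 : c (u 0) (s • u 0 + (t * τ) • u 1) = 0 := by
        rw [map_add, map_smul, map_smul, ← hst, smul_smul]
      have h2 := (hnd _ _ h1).resolve_left (hu0 0)
      have h3 := Fintype.linearIndependent_iff.1 hli ![s, t * τ] (by simpa using h2)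
      exact ⟨by simpa using h3 0, by simpa [hτ0] using h3 1⟩)
    (by rw [norm_smul, Complex.norm_real, Real.norm_of_nonneg hτ.le, hτP])
    (by
      rw [norm_smul, norm_smul, norm_pow, Complex.norm_real, Real.norm_of_nonneg hτ.le, hτS]
      ring)
    (by
      rw [inner_smul_right, inner_smul_right, inner_smul_left, hτi, Complex.conj_ofReal]
      ring)
  -- With first coordinate `s`, the coordinates of `P, S, Q` are `s, s z / τ, s z² / τ²`: the
  -- symmetric rank-one matrix `s (1, z/τ) ⊗ (1, z/τ)`.
  refine factorizes_of_expansion u u (fun a i => p.repr a i) (fun a i => p.repr a i)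
    (fun a x => by simpa only [hp] using bilinear_basis_expansion c p p a x) ⟨e, fun k =>
      ⟨![inner ℂ (e k) (c (u 0) (u 0)), z k * inner ℂ (e k) (c (u 0) (u 0)) / τ],
        ![1, z k / τ], ?_⟩⟩
  obtain ⟨hz1, hz2⟩ := hz k
  simp only [inner_smul_right] at hz1 hz2
  have hz1' : inner ℂ (e k) (c (u 0) (u 1)) = z k * inner ℂ (e k) (c (u 0) (u 0)) / τ := by
    rw [eq_div_iff hτ0, ← hz1, mul_comm]
  have hz2' : inner ℂ (e k) (c (u 1) (u 1)) =
      z k * inner ℂ (e k) (c (u 0) (u 0)) / τ * (z k / τ) := by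
    rw [hz1] at hz2
    field_simp
    linear_combination hz2
  intro i j
  fin_cases i <;> fin_cases j
  · simp
  · simp only [Fin.zero_eta, Fin.mk_one, Matrix.cons_val_zero, Matrix.cons_val_one, hz1']
    ring
  · simp only [Fin.zero_eta, Fin.mk_one, Matrix.cons_val_zero, Matrix.cons_val_one, hS', hz1']
    ring
  · simpa using hz2'

end TwoQubits

/-! ### General two-qubit maps and assembly of the bipartite cases. -/

section Bipartite

variable {E F V : Type*} [AddCommGroup E] [Module ℂ E] [AddCommGroup F] [Module ℂ F]
  [NormedAddCommGroup V] [InnerProductSpace ℂ V]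

theorem factorizes_of_basis_mul {c : E →ₗ[ℂ] F →ₗ[ℂ] V} {ι : Type*} [Fintype ι]
    (e : OrthonormalBasis ι ℂ V) (p : Module.Basis (Fin 2) ℂ E) (q : Module.Basis (Fin 2) ℂ F)
    (h : ∀ k, ∃ α β : Fin 2 → ℂ, ∀ i j, inner ℂ (e k) (c (p i) (q j)) = α i * β j) :
    Factorizes c := by
  have hcard : Fintype.card ι = Module.finrank ℂ V := (Module.finrank_eq_card_basis e.toBasis).symm
  refine factorizes_of_expansion p q (fun a i => p.repr a i) (fun x j => q.repr x j)
    (bilinear_basis_expansion c p q)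
    ⟨e.reindex (Fintype.equivFinOfCardEq hcard), fun k => ?_⟩
  rw [e.reindex_apply]
  exact h _

variable [FiniteDimensional ℂ V]

theorem HasTotalRange.span_eq_top {c : E →ₗ[ℂ] F →ₗ[ℂ] V} (ht : HasTotalRange c)
    {s : Submodule ℂ V} (hs : ∀ a x, c a x ∈ s) : s = ⊤ := by
  by_contra h
  obtain ⟨w, hw, hw'⟩ := exists_orthogonal_ne_zero h
  exact hw (ht w fun a x => hw' _ (hs a x))

theorem linearIndependent_triple_of_total {c : E →ₗ[ℂ] F →ₗ[ℂ] V} (ht : HasTotalRange c)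
    (hV : Module.finrank ℂ V = 3) (p : Module.Basis (Fin 2) ℂ E) (q : Module.Basis (Fin 2) ℂ F)
    {v : Fin 3 → V} (hv : ∀ i j, c (p i) (q j) ∈ Submodule.span ℂ (Set.range v)) :
    LinearIndependent ℂ v := by
  refine linearIndependent_of_top_le_span_of_card_eq_finrank (ht.span_eq_top fun a x => ?_).ge
    (by simp [hV])
  rw [bilinear_basis_expansion c p q]
  exact Submodule.sum_mem _ fun i _ => Submodule.sum_mem _ fun j _ =>
    Submodule.smul_mem _ _ (hv i j)

/-- The two-qubit case with a product vector in the kernel. -/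
theorem factorizes_of_product_kernel {c : E →ₗ[ℂ] F →ₗ[ℂ] V} (hc : HasLowRankTranspose c)
    (ht : HasTotalRange c) (hV : Module.finrank ℂ V = 3) (p : Module.Basis (Fin 2) ℂ E)
    (q : Module.Basis (Fin 2) ℂ F) (h0 : c (p 0) (q 0) = 0) : Factorizes c := by
  have hli : LinearIndependent ℂ ![c (p 0) (q 1), c (p 1) (q 0), c (p 1) (q 1)] := by
    refine linearIndependent_triple_of_total ht hV p q fun i j => ?_
    fin_cases i <;> fin_cases j
    · simp [h0]
    · exact Submodule.subset_span ⟨0, rfl⟩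
    · exact Submodule.subset_span ⟨1, rfl⟩
    · exact Submodule.subset_span ⟨2, rfl⟩
  have hs : c (p 0) (q 1) ≠ 0 := hli.ne_zero 0
  have hu : c (p 1) (q 0) ≠ 0 := hli.ne_zero 1
  -- Since `c (p 0) (q 0) = 0`, the minor on the product basis is, up to sign, `|⟨s, u⟩|² ‖s‖² ‖u‖²`
  -- with `s = c (p 0) (q 1)` and `u = c (p 1) (q 0)`.
  have horth : inner ℂ (c (p 0) (q 1)) (c (p 1) (q 0)) = 0 := by
    have h := hc ![p 0, p 0, p 1, p 1] ![q 0, q 1, q 0, q 1] ![p 0, p 0, p 1, p 1]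
      ![q 0, q 1, q 0, q 1]
    rw [Matrix.det_succ_row_zero] at h
    simp [Fin.sum_univ_succ, h0, Matrix.det_fin_three, Fin.succAbove, hs, hu] at h
    rcases h with h | h
    · exact inner_eq_zero_symm.1 h
    · exact h
  have hs' : (‖c (p 0) (q 1)‖ : ℂ) ≠ 0 := by simpa using hs
  have hu' : (‖c (p 1) (q 0)‖ : ℂ) ≠ 0 := by simpa using hu
  obtain ⟨e, he0, he1⟩ := exists_orthonormalBasis_extending_pair hV
    (u := (‖c (p 0) (q 1)‖ : ℂ)⁻¹ • c (p 0) (q 1)) (v := (‖c (p 1) (q 0)‖ : ℂ)⁻¹ • c (p 1) (q 0))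
    (by simp [norm_smul, hs]) (by simp [norm_smul, hu])
    (by rw [inner_smul_left, inner_smul_right, horth]; simp)
  have hs1 : c (p 0) (q 1) = (‖c (p 0) (q 1)‖ : ℂ) • e 0 := by
    rw [he0, smul_smul, mul_inv_cancel₀ hs', one_smul]
  have hu1 : c (p 1) (q 0) = (‖c (p 1) (q 0)‖ : ℂ) • e 1 := by
    rw [he1, smul_smul, mul_inv_cancel₀ hu', one_smul]
  have hs2 : ∀ k, k ≠ 0 → inner ℂ (e k) (c (p 0) (q 1)) = 0 := by
    intro k hk
    rw [hs1, inner_smul_right, e.inner_eq_ite, if_neg hk, mul_zero]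
  have hu2 : ∀ k, k ≠ 1 → inner ℂ (e k) (c (p 1) (q 0)) = 0 := by
    intro k hk
    rw [hu1, inner_smul_right, e.inner_eq_ite, if_neg hk, mul_zero]
  -- Each coordinate matrix vanishes at `(0, 0)` and at one off-diagonal place, so only a row or a
  -- column is left.
  refine factorizes_of_basis_mul e p q fun k => ?_
  by_cases hk : k = 1
  · refine ⟨![0, 1], ![inner ℂ (e k) (c (p 1) (q 0)), inner ℂ (e k) (c (p 1) (q 1))],
      fun i j => ?_⟩
    have := hs2 k (by rw [hk]; decide)
    fin_cases i <;> fin_cases j <;> simp [h0, this]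
  · refine ⟨![inner ℂ (e k) (c (p 0) (q 1)), inner ℂ (e k) (c (p 1) (q 1))], ![0, 1],
      fun i j => ?_⟩
    have := hu2 k hk
    fin_cases i <;> fin_cases j <;> simp [h0, this]

theorem exists_basis_apply_zero_eq {E : Type*} [AddCommGroup E] [Module ℂ E]
    (hE : Module.finrank ℂ E = 2) {a : E} (ha : a ≠ 0) :
    ∃ p : Module.Basis (Fin 2) ℂ E, p 0 = a := by
  obtain ⟨b, hb⟩ := exists_linearIndependent_pair_of_one_lt_finrank (R := ℂ) (by omega) ha
  exact ⟨basisOfLinearIndependentOfCardEqFinrank hb (by simp [hE]), by simp⟩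

/-- Four vectors in dimension three are dependent, so some nonzero tensor in `ℂ² ⊗ ℂ²` is killed. If
no product vector is killed, this tensor has rank two, and a basis change in the second factor turns
it into the singlet, making `c` symmetric. -/
theorem factorizes_of_two_qubits {c : (Fin 2 → ℂ) →ₗ[ℂ] (Fin 2 → ℂ) →ₗ[ℂ] V}
    (hc : HasLowRankTranspose c) (ht : HasTotalRange c) (hV : Module.finrank ℂ V = 3) :
    Factorizes c := by
  by_cases hnd : ∀ u v, c u v = 0 → u = 0 ∨ v = 0
  swap
  · push Not at hnd
    obtain ⟨u, v, huv, hu, hv⟩ := hnd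
    obtain ⟨p, rfl⟩ := exists_basis_apply_zero_eq (by simp) hu
    obtain ⟨q, rfl⟩ := exists_basis_apply_zero_eq (by simp) hv
    exact factorizes_of_product_kernel hc ht hV p q huv
  obtain ⟨X, hX, hX0⟩ : ∃ X : Fin 2 → Fin 2 → ℂ,
      c (Pi.single 0 1) (X 0) + c (Pi.single 1 1) (X 1) = 0 ∧ X ≠ 0 := by
    have hdep : ¬ LinearIndependent ℂ fun ij : Fin 2 × Fin 2 =>
        c (Pi.single ij.1 1) (Pi.single ij.2 1) := by
      intro hli
      have := hli.fintype_card_le_finrank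
      simp [hV] at this
    rw [Fintype.not_linearIndependent_iff] at hdep
    obtain ⟨g, hg, ij, hij⟩ := hdep
    refine ⟨fun i j => g (i, j), ?_, fun h => hij (congrFun (congrFun h ij.1) ij.2)⟩
    rw [← hg, Fintype.sum_prod_type, Fin.sum_univ_two]
    beta_reduce
    congr 1
    · conv_lhs => rw [← (Pi.basisFun ℂ (Fin 2)).sum_repr (fun j => g (0, j))]
      simp
    · conv_lhs => rw [← (Pi.basisFun ℂ (Fin 2)).sum_repr (fun j => g (1, j))]
      simp
  -- Were `X 0` and `X 1` proportional, some nonzero first argument would kill both of them, against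
  -- `hnd`.
  have hliX : LinearIndependent ℂ ![-X 1, X 0] := by
    rw [LinearIndependent.pair_iff]
    intro s t hst
    by_contra hne
    have hdep : s • X 1 = t • X 0 := by
      rw [smul_neg] at hst
      exact (neg_add_eq_zero.1 hst)
    have k1 : c (s • Pi.single 0 1 + t • Pi.single 1 1) (X 0) = 0 := by
      have : c (Pi.single 1 1) (t • X 0) = s • c (Pi.single 1 1) (X 1) := by
        rw [← hdep, map_smul]
      rw [map_smul] at this
      simp only [map_add, map_smul, LinearMap.add_apply, LinearMap.smul_apply]
      rw [this, ← smul_add, hX, smul_zero]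
    have k2 : c (s • Pi.single 0 1 + t • Pi.single 1 1) (X 1) = 0 := by
      have : c (Pi.single 0 1) (s • X 1) = t • c (Pi.single 0 1) (X 0) := by
        rw [hdep, map_smul]
      rw [map_smul] at this
      simp only [map_add, map_smul, LinearMap.add_apply, LinearMap.smul_apply]
      rw [this, ← smul_add, hX, smul_zero]
    have hne' : s • Pi.single 0 1 + t • Pi.single 1 1 ≠ (0 : Fin 2 → ℂ) := by
      intro h
      exact hne ⟨by simpa using congrFun h 0, by simpa using congrFun h 1⟩
    have x0 := (hnd _ _ k1).resolve_left hne'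
    have x1 := (hnd _ _ k2).resolve_left hne'
    apply hX0
    ext i : 1
    fin_cases i
    · exact x0
    · exact x1
  -- In the basis `(-X 1, X 0)` the relation `hX` says that `c'` agrees on `(e₀, e₁)` and `(e₁,
  -- e₀)`.
  let q := basisOfLinearIndependentOfCardEqFinrank hliX (by simp)
  let c' := c.compl₁₂ LinearMap.id q.equivFun.symm.toLinearMap
  have hc' : ∀ u v, c' u v = c u (q.equivFun.symm v) := fun u v => rfl
  have hq : ∀ v, q.equivFun.symm v = v 0 • -X 1 + v 1 • X 0 := by
    intro v
    simp [q, Module.Basis.equivFun_symm_apply]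
  have hfac : Factorizes c' := by
    refine factorizes_of_symmetric (hc.comp _ _) (fun u v => ?_) (fun u v huv => ?_)
    · have hX' : c (Pi.single 0 1) (X 0) = - c (Pi.single 1 1) (X 1) := eq_neg_of_add_eq_zero_left hX
      have hexp : ∀ (u : Fin 2 → ℂ) w, c u w = u 0 • c (Pi.single 0 1) w
          + u 1 • c (Pi.single 1 1) w := by
        intro u w
        conv_lhs => rw [← (Pi.basisFun ℂ (Fin 2)).sum_repr u]
        simp
      rw [hc', hc', hq, hq, hexp u, hexp v]
      simp only [map_add, map_smul, map_neg, hX']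
      module
    · exact (hnd _ _ huv).imp_right (LinearEquiv.map_eq_zero_iff _).1
  obtain ⟨e, he⟩ := hfac
  refine ⟨e, fun k => ?_⟩
  obtain ⟨α, β, h⟩ := he k
  refine ⟨α, fun x => β (q.equivFun x), fun a x => ?_⟩
  rw [← h, hc', LinearEquiv.symm_apply_apply]

/-- The vectors `c a x` of a total family in dimension at most three factorize as soon as the
partial transpose of their Gram matrix has rank at most three. -/
theorem factorizes_of_finrank_le_three {c : E →ₗ[ℂ] F →ₗ[ℂ] V} (hc : HasLowRankTranspose c)
    (ht : HasTotalRange c) (hV : Module.finrank ℂ V ≤ 3) : Factorizes c := by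
  obtain h | h | h | h : Module.finrank ℂ V = 0 ∨ Module.finrank ℂ V = 1 ∨
    Module.finrank ℂ V = 2 ∨ Module.finrank ℂ V = 3 := by omega
  · have : IsEmpty (Fin (Module.finrank ℂ V)) := by rw [h]; infer_instance
    exact ⟨stdOrthonormalBasis ℂ V, fun k => isEmptyElim k⟩
  · exact factorizes_of_finrank_eq_one hc h
  · by_cases hs : ∃ a x x', LinearIndependent ℂ ![c a x, c a x']
    · obtain ⟨a, x, x', hli⟩ := hs
      refine factorizes_of_surjective_two hc h a (LinearMap.range_eq_top.1 ?_)
      have htop := hli.span_eq_top_of_card_eq_finrank (by simp [h])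
      rw [eq_top_iff, ← htop, Submodule.span_le]
      rintro _ ⟨i, rfl⟩
      fin_cases i
      · exact ⟨x, rfl⟩
      · exact ⟨x', rfl⟩
    · push Not at hs
      exact factorizes_of_rank_le_one ht h.ge hs
  · by_cases hsE : ∃ a, Function.Surjective (c a)
    · obtain ⟨a, ha⟩ := hsE
      exact factorizes_of_surjective_three hc h a ha
    by_cases hsF : ∃ x, Function.Surjective (c.flip x)
    · obtain ⟨x, hx⟩ := hsF
      exact (factorizes_of_surjective_three hc.flip h x hx).of_flip
    by_cases hE : ∃ a x x', LinearIndependent ℂ ![c a x, c a x']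
    swap
    · push Not at hE
      exact factorizes_of_rank_le_one ht (by omega) hE
    by_cases hF : ∃ x a a', LinearIndependent ℂ ![c.flip x a, c.flip x a']
    swap
    · push Not at hF
      exact (factorizes_of_rank_le_one ht.flip (by omega) hF).of_flip
    push Not at hsE hsF
    obtain ⟨a, x, x', hli⟩ := hE
    obtain ⟨y, g, hg⟩ := exists_expansion_of_rank_two hc h hsE hli
    obtain ⟨x, a, a', hli'⟩ := hF
    obtain ⟨b, f, hf⟩ := exists_expansion_of_rank_two hc.flip h hsF hli'
    have hexp : ∀ a x, c a x = ∑ i, ∑ j, (f a i * g x j) • c (b i) (y j) := by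
      intro a x
      have h1 : c a x = ∑ i, f a i • c (b i) x := hf x a
      rw [h1]
      refine Finset.sum_congr rfl fun i _ => ?_
      rw [hg, Finset.smul_sum]
      simp only [smul_smul]
    -- Pulling back to `ℂ² × ℂ²` needs no independence of `b` or `y`; by `hexp` the pullback keeps
    -- total range.
    let c' := c.compl₁₂ (Fintype.linearCombination ℂ b) (Fintype.linearCombination ℂ y)
    have hc' : ∀ i j, c' (Pi.single i 1) (Pi.single j 1) = c (b i) (y j) := by
      intro i j
      simp [c']
    have hfac : Factorizes c' := by
      refine factorizes_of_two_qubits (hc.comp _ _) (fun w hw => ht w fun a x => ?_) h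
      rw [hexp, inner_sum]
      refine Finset.sum_eq_zero fun i _ => ?_
      rw [inner_sum]
      refine Finset.sum_eq_zero fun j _ => ?_
      rw [inner_smul_right, ← hc', hw, mul_zero]
    obtain ⟨e, he⟩ := hfac
    refine factorizes_of_expansion b y f g hexp ⟨e, fun k => ?_⟩
    obtain ⟨α, β, hαβ⟩ := he k
    exact ⟨fun i => α (Pi.single i 1), fun j => β (Pi.single j 1), fun i j => by
      rw [← hc', hαβ]⟩

end Bipartite

/-! ### From operators to bilinear maps: the bipartite decomposition, slices and functionals. -/

section GramMatrix

variable {A B : Type*} [Fintype A] [Fintype B]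

/-- The partial transpose of a bipartite operator with respect to the first party. -/
def bipartiteTranspose (ρ : Matrix (A × B) (A × B) ℂ) : Matrix (A × B) (A × B) ℂ :=
  Matrix.of fun p q => ρ (q.1, p.2) (p.1, q.2)

theorem det_eq_zero_of_rank_lt {ι : Type*} [Fintype ι] [DecidableEq ι] (M : Matrix ι ι ℂ)
    (h : M.rank < Fintype.card ι) : M.det = 0 := by
  by_contra hne
  have := Matrix.rank_of_isUnit M ((Matrix.isUnit_iff_isUnit_det M).2 (isUnit_iff_ne_zero.2 hne))
  omega

/-- The bilinear map with values `v (a, x)` on pairs of basis vectors. -/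
noncomputable def bilinearOfFamily {V : Type*} [AddCommGroup V] [Module ℂ V] (v : A × B → V) :
    (A → ℂ) →ₗ[ℂ] (B → ℂ) →ₗ[ℂ] V :=
  LinearMap.mk₂ ℂ (fun u w => ∑ p, (u p.1 * w p.2) • v p)
    (fun u u' w => by simp only [Pi.add_apply, add_mul, add_smul, Finset.sum_add_distrib])
    (fun t u w => by simp only [Pi.smul_apply, smul_eq_mul, mul_assoc, mul_smul, Finset.smul_sum])
    (fun u w w' => by simp only [Pi.add_apply, mul_add, add_smul, Finset.sum_add_distrib])
    (fun t u w => by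
      simp only [Pi.smul_apply, smul_eq_mul, mul_left_comm _ t, mul_smul, Finset.smul_sum])

theorem bilinearOfFamily_apply {V : Type*} [AddCommGroup V] [Module ℂ V] (v : A × B → V)
    (u : A → ℂ) (w : B → ℂ) : bilinearOfFamily v u w = ∑ p, (u p.1 * w p.2) • v p := rfl

theorem bilinearOfFamily_single {V : Type*} [AddCommGroup V] [Module ℂ V] [DecidableEq A]
    [DecidableEq B] (v : A × B → V) (p : A × B) :
    bilinearOfFamily v (Pi.single p.1 1) (Pi.single p.2 1) = v p := by
  rw [bilinearOfFamily_apply, Finset.sum_eq_single p]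
  · simp
  · rintro ⟨a, x⟩ - hne
    by_cases ha : a = p.1
    · have hx : x ≠ p.2 := fun hx => hne (Prod.ext ha hx)
      simp [hx]
    · simp [ha]
  · simp

/-- Each matrix in question is `L * ρ^Γ * R` with `L` and `R` encoding the chosen vectors, so its
rank is below four. -/
theorem hasLowRankTranspose_bilinearOfFamily {V : Type*} [NormedAddCommGroup V]
    [InnerProductSpace ℂ V] {ρ : Matrix (A × B) (A × B) ℂ} (v : A × B → V)
    (hv : ∀ p q, inner ℂ (v p) (v q) = ρ p q) (hρ : (bipartiteTranspose ρ).rank ≤ 3) :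
    HasLowRankTranspose (bilinearOfFamily v) := by
  intro a x b y
  let L : Matrix (Fin 4) (A × B) ℂ := Matrix.of fun i r => a i r.1 * (starRingEnd ℂ) (x i r.2)
  let R : Matrix (A × B) (Fin 4) ℂ := Matrix.of fun s j => (starRingEnd ℂ) (b j s.1) * y j s.2
  have h : (Matrix.of fun i j => inner ℂ (bilinearOfFamily v (b j) (x i))
      (bilinearOfFamily v (a i) (y j))) = L * bipartiteTranspose ρ * R := by
    ext i j
    simp only [bilinearOfFamily_apply, Matrix.of_apply, sum_inner, inner_sum, inner_smul_left,
      inner_smul_right, hv, Matrix.mul_apply, Finset.sum_mul,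
      Finset.mul_sum]
    rw [← Fintype.sum_prod_type', ← Fintype.sum_prod_type']
    let φ : (A × B) × (A × B) ≃ (A × B) × (A × B) :=
      { toFun := fun t => ((t.2.1, t.1.2), (t.1.1, t.2.2))
        invFun := fun t => ((t.2.1, t.1.2), (t.1.1, t.2.2))
        left_inv := fun _ => rfl
        right_inv := fun _ => rfl }
    refine Fintype.sum_equiv φ _ _ fun t => ?_
    simp only [φ, L, R, bipartiteTranspose, Matrix.of_apply, Equiv.coe_fn_mk, map_mul]
    ring
  rw [h]
  apply det_eq_zero_of_rank_lt
  have h1 := (Matrix.rank_mul_le_left (L * bipartiteTranspose ρ) R).trans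
    (Matrix.rank_mul_le_right L _)
  simp only [Fintype.card_fin]
  omega

/-- A bipartite positive semidefinite operator of rank at most three whose partial transpose has
rank at most three is a sum of at most three product states. -/
theorem exists_bipartite_decomposition {ρ : Matrix (A × B) (A × B) ℂ} (hρ : ρ.PosSemidef)
    (hrank : ρ.rank ≤ 3) (hrank' : (bipartiteTranspose ρ).rank ≤ 3) :
    ∃ (m : ℕ) (_ : m ≤ 3) (α : Fin m → A → ℂ) (β : Fin m → B → ℂ), ∀ p q,
      ρ p q = ∑ k, (starRingEnd ℂ) (α k p.1 * β k p.2) * (α k q.1 * β k q.2) := by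
  classical
  obtain ⟨N, C, rfl⟩ : ∃ (N : ℕ) (C : Matrix (Fin N) (A × B) ℂ), ρ = C.conjTranspose * C := by
    obtain ⟨N, w, rfl⟩ := Matrix.posSemidef_iff_eq_sum_vecMulVec.1 hρ
    refine ⟨N, Matrix.of fun i p => star (w i p), ?_⟩
    ext p q
    simp [Matrix.sum_apply, Matrix.mul_apply, Matrix.vecMulVec_apply]
  let v₀ : A × B → EuclideanSpace ℂ (Fin N) := fun p => WithLp.toLp 2 (C.col p)
  -- Restricting to the span of the columns makes the dimension equal to the rank and the range
  -- total.
  let V := Submodule.span ℂ (Set.range v₀)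
  let v : A × B → V := fun p => ⟨v₀ p, Submodule.subset_span ⟨p, rfl⟩⟩
  have hv : ∀ p q, inner ℂ (v p) (v q) = (C.conjTranspose * C) p q := by
    intro p q
    simp only [v, v₀, Submodule.coe_inner, PiLp.inner_apply, Matrix.mul_apply,
      Matrix.conjTranspose_apply, Matrix.col_apply, RCLike.inner_apply, Complex.star_def]
    exact Finset.sum_congr rfl fun _ _ => mul_comm _ _
  have hfin : Module.finrank ℂ V ≤ 3 := by
    rw [Matrix.rank_conjTranspose_mul_self, Matrix.rank_eq_finrank_span_cols] at hrank
    refine le_of_eq_of_le ?_ hrank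
    have : V = (Submodule.span ℂ (Set.range C.col)).map
        (WithLp.linearEquiv 2 ℂ (Fin N → ℂ)).symm.toLinearMap := by
      rw [Submodule.map_span, ← Set.range_comp]
      rfl
    rw [this]
    exact LinearEquiv.finrank_map_eq _ _
  have ht : HasTotalRange (bilinearOfFamily v) := by
    intro w hw
    have h1 : ∀ z ∈ V, inner ℂ (w : EuclideanSpace ℂ (Fin N)) z = 0 := by
      intro z hz
      induction hz using Submodule.span_induction with
      | mem z hz =>
        obtain ⟨p, rfl⟩ := hz
        have := hw (Pi.single p.1 1) (Pi.single p.2 1)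
        rwa [bilinearOfFamily_single] at this
      | zero => simp
      | add z z' _ _ h h' => rw [inner_add_right, h, h', add_zero]
      | smul t z _ h => rw [inner_smul_right, h, mul_zero]
    have h2 := h1 w w.2
    rw [inner_self_eq_zero] at h2
    exact Subtype.ext h2
  obtain ⟨e, he⟩ := factorizes_of_finrank_le_three
    (hasLowRankTranspose_bilinearOfFamily v hv hrank') ht hfin
  choose α β hαβ using he
  refine ⟨_, hfin, fun k a => α k (Pi.single a 1), fun k x => β k (Pi.single x 1), fun p q => ?_⟩
  rw [← hv, ← e.sum_inner_mul_inner]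
  refine Finset.sum_congr rfl fun k _ => ?_
  rw [← inner_conj_symm, ← bilinearOfFamily_single v p, ← bilinearOfFamily_single v q, hαβ, hαβ]

/-- A slice is the compression `(f ⊗ 1) M (g ⊗ 1)` to the second party. Independent `f` and `g` are
what later allows one term among three to be isolated. -/
theorem rank_slice_le [DecidableEq B] (M : Matrix (A × B) (A × B) ℂ) (f g : A → ℂ) :
    (Matrix.of fun x y => ∑ a, ∑ b, f a * g b * M (a, x) (b, y)).rank ≤ M.rank := by
  let L : Matrix B (A × B) ℂ := Matrix.of fun x p => if x = p.2 then f p.1 else 0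
  let R : Matrix (A × B) B ℂ := Matrix.of fun p y => if p.2 = y then g p.1 else 0
  have h : (Matrix.of fun x y => ∑ a, ∑ b, f a * g b * M (a, x) (b, y)) = L * M * R := by
    ext x y
    simp only [Matrix.of_apply, Matrix.mul_apply, Fintype.sum_prod_type, L, R]
    simp only [mul_ite, mul_zero, Finset.sum_ite_eq', Finset.mem_univ, if_true, ite_mul, zero_mul,
      Finset.sum_ite_eq, Finset.sum_mul]
    rw [Finset.sum_comm]
    refine Finset.sum_congr rfl fun b _ => Finset.sum_congr rfl fun a _ => ?_
    ring
  rw [h]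
  exact (Matrix.rank_mul_le_left _ _).trans (Matrix.rank_mul_le_right _ _)

/-- A linear functional annihilating `u` but not `v`. -/
theorem exists_annihilating_functional {u v : A → ℂ} (hu : u ≠ 0) (h : ∀ t : ℂ, v ≠ t • u) :
    ∃ f : A → ℂ, ∑ a, f a * u a = 0 ∧ ∑ a, f a * v a ≠ 0 := by
  classical
  obtain ⟨a, ha⟩ := Function.ne_iff.1 hu
  obtain ⟨b, hb⟩ : ∃ b, u a * v b - u b * v a ≠ 0 := by
    by_contra! hall
    refine h (v a / u a) (funext fun b => ?_)
    have := hall b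
    simp only [Pi.zero_apply] at ha
    rw [Pi.smul_apply, smul_eq_mul, div_mul_eq_mul_div, eq_div_iff ha]
    linear_combination this
  -- The functional `w ↦ u a * w b - u b * w a`, a `2 × 2` minor with `u`.
  refine ⟨u a • Pi.single b 1 - u b • Pi.single a 1, ?_, ?_⟩
  · simp [sub_mul, Finset.sum_sub_distrib, Pi.single_apply, mul_comm (u a)]
  · simpa [sub_mul, Finset.sum_sub_distrib, Pi.single_apply] using hb

end GramMatrix

/-! ### Separable operators and splitting off the first party. -/

section Separability

variable {n : ℕ}

namespace IsSeparableState

theorem zero {d : Fin n → ℕ} :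
    IsSeparableState (0 : Matrix (LocalBasis d) (LocalBasis d) ℂ) :=
  ⟨0, Fin.elim0, fun k => k.elim0, fun k => k.elim0, by simp⟩

theorem add {d : Fin n → ℕ} {ρ σ : Matrix (LocalBasis d) (LocalBasis d) ℂ}
    (hρ : IsSeparableState ρ) (hσ : IsSeparableState σ) : IsSeparableState (ρ + σ) := by
  obtain ⟨N, p, a, hp, rfl⟩ := hρ
  obtain ⟨M, q, b, hq, rfl⟩ := hσ
  refine ⟨N + M, Fin.append p q, Fin.append a b, fun k => ?_, ?_⟩
  · refine Fin.addCases (fun i => ?_) (fun i => ?_) k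
    · simpa using hp i
    · simpa using hq i
  · simp [Fin.sum_univ_add]

theorem sum {d : Fin n → ℕ} {ι : Type*} (s : Finset ι)
    {ρ : ι → Matrix (LocalBasis d) (LocalBasis d) ℂ} (h : ∀ k ∈ s, IsSeparableState (ρ k)) :
    IsSeparableState (∑ k ∈ s, ρ k) :=
  Finset.sum_induction _ _ (fun _ _ => add) zero h

/-- Transposing a local factor `|a⟩⟨a|` conjugates `a`, so product states stay product states. -/
theorem partialTranspose {d : Fin n → ℕ} {ρ : Matrix (LocalBasis d) (LocalBasis d) ℂ}
    (hρ : IsSeparableState ρ) (S : Finset (Fin n)) :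
    IsSeparableState (partialTranspose S ρ) := by
  obtain ⟨N, p, a, hp, rfl⟩ := hρ
  refine ⟨N, p, fun k i => if i ∈ S then star (a k i) else a k i, hp, ?_⟩
  ext x y
  simp only [_root_.partialTranspose, Matrix.of_apply, Matrix.sum_apply, Matrix.smul_apply,
    Matrix.vecMulVec_apply, productVector, Pi.star_apply, star_prod]
  refine Finset.sum_congr rfl fun k _ => ?_
  rw [← Finset.prod_mul_distrib, ← Finset.prod_mul_distrib]
  congr 1
  refine Finset.prod_congr rfl fun i _ => ?_
  by_cases hi : i ∈ S
  · simp [hi, mul_comm]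
  · simp [hi]

/-- Adjoining a party in a pure state. -/
theorem adjoin {d : Fin (n + 1) → ℕ}
    {σ : Matrix (LocalBasis fun i => d i.succ) (LocalBasis fun i => d i.succ) ℂ}
    (hσ : IsSeparableState σ) (α : Fin (d 0) → ℂ) :
    IsSeparableState (Matrix.of fun x y : LocalBasis d =>
      (starRingEnd ℂ) (α (x 0)) * α (y 0) * σ (fun i => x i.succ) (fun i => y i.succ)) := by
  obtain ⟨N, p, a, hp, rfl⟩ := hσ
  -- The conjugation sits on the row index in `conj (α (x 0)) * α (y 0)`, so the adjoined vector is
  -- `star α`.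
  refine ⟨N, p, fun k => Fin.cons (star α) (a k), hp, ?_⟩
  ext x y
  simp only [Matrix.of_apply, Matrix.sum_apply, Matrix.smul_apply, Matrix.vecMulVec_apply,
    productVector, Pi.star_apply, Fin.prod_univ_succ, Fin.cons_zero, Fin.cons_succ, smul_eq_mul,
    Finset.mul_sum]
  refine Finset.sum_congr rfl fun k _ => ?_
  simp only [star_mul', Complex.star_def, Complex.conj_conj]
  ring

end IsSeparableState

theorem isSeparableState_of_no_parties {d : Fin 0 → ℕ}
    {ρ : Matrix (LocalBasis d) (LocalBasis d) ℂ} (hρ : IsState ρ) : IsSeparableState ρ := by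
  have hnn : 0 ≤ ρ default default := Matrix.PosSemidef.diag_nonneg hρ
  refine ⟨1, fun _ => (ρ default default).re, fun _ i => i.elim0,
    fun _ => (Complex.nonneg_iff.1 hnn).1, ?_⟩
  ext x y
  rw [Subsingleton.elim x default, Subsingleton.elim y default]
  simp only [Finset.univ_unique, Finset.sum_const, Finset.card_singleton, one_smul,
    Matrix.smul_apply, Matrix.vecMulVec_apply, productVector, Pi.star_apply,
    Finset.univ_eq_empty, Finset.prod_empty, star_one, mul_one, smul_eq_mul]
  exact Complex.ext (by simp) (by simpa using (Complex.nonneg_iff.1 hnn).2.symm)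

/-- The first party and the others, as a bipartite index. -/
def splitFirst (d : Fin (n + 1) → ℕ) :
    Fin (d 0) × LocalBasis (fun i => d i.succ) ≃ LocalBasis d :=
  Fin.consEquiv fun i => Fin (d i)

theorem splitFirst_zero {d : Fin (n + 1) → ℕ}
    (p : Fin (d 0) × LocalBasis (fun i => d i.succ)) : splitFirst d p 0 = p.1 := rfl

theorem splitFirst_succ {d : Fin (n + 1) → ℕ}
    (p : Fin (d 0) × LocalBasis (fun i => d i.succ)) (i : Fin n) :
    splitFirst d p i.succ = p.2 i := rfl

theorem rank_bipartiteTranspose_splitFirst {d : Fin (n + 1) → ℕ}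
    (ρ : Matrix (LocalBasis d) (LocalBasis d) ℂ) :
    (bipartiteTranspose (ρ.submatrix (splitFirst d) (splitFirst d))).rank =
      (partialTranspose {0} ρ).rank := by
  rw [← Matrix.rank_submatrix (partialTranspose {0} ρ) (splitFirst d) (splitFirst d)]
  congr 1
  ext p q
  simp only [bipartiteTranspose, partialTranspose, Matrix.of_apply, Matrix.submatrix_apply]
  congr 1 <;> funext i <;> refine Fin.cases ?_ (fun j => ?_) i <;>
    simp [splitFirst_zero, splitFirst_succ]

/-- A matrix given as a sum of tensor products with the first party. -/
def IsTensorSum {d : Fin (n + 1) → ℕ} {ι : Type*} (s : Finset ι) (α : ι → Fin (d 0) → ℂ)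
    (σ : ι → Matrix (LocalBasis fun i => d i.succ) (LocalBasis fun i => d i.succ) ℂ)
    (ρ : Matrix (LocalBasis d) (LocalBasis d) ℂ) : Prop :=
  ∀ x y, ρ x y = ∑ k ∈ s, (starRingEnd ℂ) (α k (x 0)) * α k (y 0) *
    σ k (fun i => x i.succ) (fun i => y i.succ)

/-- A summand singled out by functionals on the first party inherits the rank bound. -/
theorem rank_partialTranspose_summand_le {d : Fin (n + 1) → ℕ} {ι : Type*} {s : Finset ι}
    {α : ι → Fin (d 0) → ℂ}
    {σ : ι → Matrix (LocalBasis fun i => d i.succ) (LocalBasis fun i => d i.succ) ℂ}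
    {ρ : Matrix (LocalBasis d) (LocalBasis d) ℂ} (hρ : IsTensorSum s α σ ρ) {k : ι} (hk : k ∈ s)
    (f g : Fin (d 0) → ℂ) (hfk : ∑ a, f a * α k a ≠ 0) (hgk : ∑ a, g a * α k a ≠ 0)
    (hfg : ∀ j ∈ s, j ≠ k → ∑ a, f a * α j a = 0 ∨ ∑ a, g a * α j a = 0)
    (S : Finset (Fin n)) :
    (partialTranspose S (σ k)).rank ≤ (partialTranspose (S.map (Fin.succEmb n)) ρ).rank := by
  -- The shifted `S` omits the first party, so the transposition acts on the `σ j` alone. Slicing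
  -- with `conj f` and `g` multiplies term `j` by `conj (f · α j) * (g · α j)`, which is zero for `j
  -- ≠ k`.
  have h := rank_slice_le ((partialTranspose (S.map (Fin.succEmb n)) ρ).submatrix (splitFirst d)
    (splitFirst d)) (fun a => (starRingEnd ℂ) (f a)) g
  rw [Matrix.rank_submatrix] at h
  have hentry : ∀ a b x y, (partialTranspose (S.map (Fin.succEmb n)) ρ).submatrix (splitFirst d)
      (splitFirst d) (a, x) (b, y) =
      ∑ j ∈ s, (starRingEnd ℂ) (α j a) * α j b * partialTranspose S (σ j) x y := by
    intro a b x y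
    simp only [partialTranspose, Matrix.of_apply, Matrix.submatrix_apply]
    rw [hρ]
    refine Finset.sum_congr rfl fun j _ => ?_
    simp [splitFirst_zero, splitFirst_succ]
  have hslice : (Matrix.of fun x y => ∑ a, ∑ b, (starRingEnd ℂ) (f a) * g b *
      (partialTranspose (S.map (Fin.succEmb n)) ρ).submatrix (splitFirst d) (splitFirst d)
        (a, x) (b, y)) =
      ((starRingEnd ℂ) (∑ a, f a * α k a) * ∑ a, g a * α k a) • partialTranspose S (σ k) := by
    ext x y
    have h1 : ∀ j ∈ s, ∑ a, ∑ b, (starRingEnd ℂ) (f a) * g b * ((starRingEnd ℂ) (α j a) * α j b *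
        partialTranspose S (σ j) x y) =
        (starRingEnd ℂ) (∑ a, f a * α j a) * (∑ a, g a * α j a) *
          partialTranspose S (σ j) x y := by
      intro j _
      rw [map_sum, Finset.sum_mul_sum, Finset.sum_mul]
      refine Finset.sum_congr rfl fun a _ => ?_
      rw [Finset.sum_mul]
      refine Finset.sum_congr rfl fun b _ => ?_
      rw [map_mul]
      ring
    obtain ⟨K, hK⟩ : ∃ K, (starRingEnd ℂ) (∑ a, f a * α k a) * ∑ a, g a * α k a = K := ⟨_, rfl⟩
    rw [hK]
    simp only [Matrix.of_apply, hentry, Finset.mul_sum]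
    simp only [Finset.sum_comm (t := s)]
    rw [Finset.sum_congr rfl h1, Finset.sum_eq_single_of_mem k hk]
    · rw [hK, Matrix.smul_apply, smul_eq_mul]
    · intro j hj hjk
      rcases hfg j hj hjk with h0 | h0 <;> simp [h0]
  rw [hslice] at h
  have hne : (starRingEnd ℂ) (∑ a, f a * α k a) * ∑ a, g a * α k a ≠ 0 :=
    mul_ne_zero ((map_ne_zero _).2 hfk) hgk
  rwa [Matrix.rank_smul_of_mem_nonZeroDivisors _ (mem_nonZeroDivisors_of_ne_zero hne)] at h

end Separability

/-! ### Isolating terms and induction on the number of parties. -/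

section Multipartite

variable {n : ℕ}

theorem exists_subset_triple {ι : Type*} [DecidableEq ι] {s : Finset ι} (hs : s.card ≤ 3) {k : ι}
    (hk : k ∈ s) : ∃ i ∈ s, ∃ j ∈ s, ∀ l ∈ s, l = k ∨ l = i ∨ l = j := by
  have hcard : (s.erase k).card ≤ 2 := by
    rw [Finset.card_erase_of_mem hk]
    omega
  obtain h | h | h : (s.erase k).card = 0 ∨ (s.erase k).card = 1 ∨ (s.erase k).card = 2 := by omega
  · rw [Finset.card_eq_zero] at h
    refine ⟨k, hk, k, hk, fun l hl => ?_⟩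
    by_contra hne
    have : l ∈ s.erase k := Finset.mem_erase.2 ⟨fun h => hne (Or.inl h), hl⟩
    simp [h] at this
  · obtain ⟨i, hi⟩ := Finset.card_eq_one.1 h
    have his : i ∈ s := Finset.mem_of_mem_erase (hi ▸ Finset.mem_singleton_self i)
    refine ⟨i, his, i, his, fun l hl => ?_⟩
    by_cases hlk : l = k
    · exact Or.inl hlk
    · have : l ∈ s.erase k := Finset.mem_erase.2 ⟨hlk, hl⟩
      rw [hi, Finset.mem_singleton] at this
      exact Or.inr (Or.inl this)
  · obtain ⟨i, j, -, hij⟩ := Finset.card_eq_two.1 h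
    refine ⟨i, Finset.mem_of_mem_erase (a := k) (by simp [hij]), j,
      Finset.mem_of_mem_erase (a := k) (by simp [hij]), fun l hl => ?_⟩
    by_cases hlk : l = k
    · exact Or.inl hlk
    · have : l ∈ s.erase k := Finset.mem_erase.2 ⟨hlk, hl⟩
      rw [hij, Finset.mem_insert, Finset.mem_singleton] at this
      exact Or.inr this

/-- Among at most three pairwise non-parallel vectors, each is singled out by a pair of
functionals. -/
theorem exists_isolating_functionals {A ι : Type*} [Fintype A] [DecidableEq ι] {s : Finset ι}
    (hs : s.card ≤ 3) {α : ι → A → ℂ} (h0 : ∀ k ∈ s, α k ≠ 0)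
    (hpar : ∀ i ∈ s, ∀ j ∈ s, i ≠ j → ∀ t : ℂ, α j ≠ t • α i) {k : ι} (hk : k ∈ s) :
    ∃ f g : A → ℂ, ∑ a, f a * α k a ≠ 0 ∧ ∑ a, g a * α k a ≠ 0 ∧
      ∀ j ∈ s, j ≠ k → ∑ a, f a * α j a = 0 ∨ ∑ a, g a * α j a = 0 := by
  have hF : ∀ i ∈ s, ∃ f : A → ℂ, ∑ a, f a * α k a ≠ 0 ∧ (i ≠ k → ∑ a, f a * α i a = 0) := by
    intro i hi
    by_cases hik : i = k
    -- `i = k` occurs as padding when fewer than two other terms exist; any functional nonzero on `α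
    -- k` serves.
    · refine ⟨star (α k), fun h => h0 k hk ?_, fun h => absurd hik h⟩
      exact dotProduct_star_self_eq_zero.1 h
    · obtain ⟨f, hf1, hf2⟩ := exists_annihilating_functional (h0 i hi) (hpar i hi k hk hik)
      exact ⟨f, hf2, fun _ => hf1⟩
  obtain ⟨i, hi, j, hj, hij⟩ := exists_subset_triple hs hk
  obtain ⟨f, hf, hf'⟩ := hF i hi
  obtain ⟨g, hg, hg'⟩ := hF j hj
  refine ⟨f, g, hf, hg, fun l hl hlk => ?_⟩
  rcases hij l hl with rfl | rfl | rfl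
  · exact absurd rfl hlk
  · exact Or.inl (hf' hlk)
  · exact Or.inr (hg' hlk)

/-- Separability of a sum of at most three tensor products, given the result for one party less. -/
theorem IsTensorSum.isSeparableState {d : Fin (n + 1) → ℕ} {ι : Type*} [DecidableEq ι]
    (ih : ∀ σ : Matrix (LocalBasis fun i => d i.succ) (LocalBasis fun i => d i.succ) ℂ,
      IsState σ → (∀ S, (partialTranspose S σ).rank ≤ 3) → IsSeparableState σ)
    {ρ : Matrix (LocalBasis d) (LocalBasis d) ℂ}
    (hrank : ∀ S, (partialTranspose S ρ).rank ≤ 3) (α : ι → Fin (d 0) → ℂ) (m : ℕ) (hm : m ≤ 3)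
    (s : Finset ι) (hs : s.card = m)
    (σ : ι → Matrix (LocalBasis fun i => d i.succ) (LocalBasis fun i => d i.succ) ℂ)
    (hσ : ∀ k, IsState (σ k)) (hρ : IsTensorSum s α σ ρ) : IsSeparableState ρ := by
  -- The rank hypothesis concerns `ρ` itself and survives rewriting the decomposition, so terms may
  -- be dropped or merged until the `α k` are nonzero and pairwise non-parallel.
  induction m generalizing s σ with
  | zero =>
    rw [Finset.card_eq_zero] at hs
    have : ρ = 0 := by
      ext x y
      rw [hρ, hs, Finset.sum_empty, Matrix.zero_apply]
    rw [this]
    exact IsSeparableState.zero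
  | succ m ihm =>
    by_cases h0 : ∃ k ∈ s, α k = 0
    · obtain ⟨k, hk, hαk⟩ := h0
      refine ihm (by omega) (s.erase k) (by rw [Finset.card_erase_of_mem hk]; omega) σ hσ
        fun x y => ?_
      rw [hρ, ← Finset.add_sum_erase s _ hk, hαk]
      simp
    by_cases hpar : ∃ i ∈ s, ∃ j ∈ s, i ≠ j ∧ ∃ t : ℂ, α j = t • α i
    · obtain ⟨i, hi, j, hj, hij, t, ht⟩ := hpar
      have hi' : i ∈ s.erase j := Finset.mem_erase.2 ⟨hij, hi⟩
      refine ihm (by omega) (s.erase j) (by rw [Finset.card_erase_of_mem hj]; omega)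
        -- If `α j = t • α i`, term `j` is absorbed into term `i` with the nonnegative weight
        -- `|t|²`.
        (Function.update σ i (σ i + ((starRingEnd ℂ) t * t) • σ j)) (fun k => ?_) fun x y => ?_
      · by_cases hk : k = i
        · subst hk
          rw [Function.update_self]
          exact Matrix.PosSemidef.add (hσ k) (Matrix.PosSemidef.smul (hσ j) (star_mul_self_nonneg t))
        · rw [Function.update_of_ne hk]
          exact hσ k
      · rw [hρ, ← Finset.add_sum_erase s _ hj, ← Finset.add_sum_erase _ _ hi',
          ← Finset.add_sum_erase (s.erase j) (fun k => (starRingEnd ℂ) (α k (x 0)) * α k (y 0) *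
            Function.update σ i _ k _ _) hi', ← add_assoc]
        congr 1
        · rw [Function.update_self, ht]
          simp only [Pi.smul_apply, smul_eq_mul, map_mul, Matrix.add_apply, Matrix.smul_apply]
          ring
        · refine Finset.sum_congr rfl fun k hk => ?_
          rw [Function.update_of_ne (Finset.ne_of_mem_erase hk)]
    push Not at h0 hpar
    have hsum : ρ = ∑ k ∈ s, Matrix.of fun x y : LocalBasis d =>
        (starRingEnd ℂ) (α k (x 0)) * α k (y 0) *
          σ k (fun i => x i.succ) (fun i => y i.succ) := by
      ext x y
      rw [hρ, Matrix.sum_apply]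
      rfl
    rw [hsum]
    refine IsSeparableState.sum s fun k hk => IsSeparableState.adjoin (ih _ (hσ k) fun S => ?_) _
    obtain ⟨f, g, hf, hg, hfg⟩ := exists_isolating_functionals (by omega) h0 hpar hk
    exact (rank_partialTranspose_summand_le hρ hk f g hf hg hfg S).trans (hrank _)

/-- The bipartite decomposition of the first party against the rest uses only `S = ∅` and `S = {0}`;
the subsystems avoiding the first party supply the rank bounds for the induction. -/
theorem isSeparableState_of_rank_partialTranspose_le_three {d : Fin n → ℕ}
    {ρ : Matrix (LocalBasis d) (LocalBasis d) ℂ} (hρ : IsState ρ)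
    (hrank : ∀ S, (partialTranspose S ρ).rank ≤ 3) : IsSeparableState ρ := by
  induction n with
  | zero => exact isSeparableState_of_no_parties hρ
  | succ n ih =>
    have hρ' : (ρ.submatrix (splitFirst d) (splitFirst d)).PosSemidef :=
      Matrix.PosSemidef.submatrix hρ _
    have hempty : partialTranspose ∅ ρ = ρ := by
      ext x y
      simp [partialTranspose]
    obtain ⟨m, hm, α, β, hαβ⟩ := exists_bipartite_decomposition hρ'
      (by rw [Matrix.rank_submatrix, ← hempty]; exact hrank ∅)
      (by rw [rank_bipartiteTranspose_splitFirst]; exact hrank {0})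
    refine IsTensorSum.isSeparableState (fun σ hσ hσr => ih hσ hσr) hrank α m hm Finset.univ
      (by simp) (fun k => Matrix.vecMulVec (star (β k)) (star (star (β k))))
      (fun k => Matrix.posSemidef_vecMulVec_self_star _) fun x y => ?_
    have := hαβ ((splitFirst d).symm x) ((splitFirst d).symm y)
    rw [Matrix.submatrix_apply, Equiv.apply_symm_apply, Equiv.apply_symm_apply] at this
    rw [this]
    refine Finset.sum_congr rfl fun k _ => ?_
    have h1 : ∀ x : LocalBasis d, ((splitFirst d).symm x).1 = x 0 := fun _ => rfl
    have h2 : ∀ x : LocalBasis d, ((splitFirst d).symm x).2 = fun i : Fin n => x i.succ := fun _ => rfl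
    simp only [h1, h2, Matrix.vecMulVec_apply, Pi.star_apply, star_star, map_mul, Complex.star_def]
    ring

end Multipartite

theorem mainTheorem6 {n : ℕ} {d : Fin n → ℕ} (ρ : Matrix (LocalBasis d) (LocalBasis d) ℂ)
    (hρ : IsState ρ)
    (hrank : ∀ S : Finset (Fin n), (partialTranspose S ρ).rank ≤ 3) :
    IsSeparableState ρ ∧ ∀ S : Finset (Fin n), IsSeparableState (partialTranspose S ρ) := by
  have h := isSeparableState_of_rank_partialTranspose_le_three hρ hrank
  exact ⟨h, fun S => h.partialTranspose S⟩
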